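/- Let $V$ be a finite-dimensional real normed space, let $[a,b]\subset\mathbb R$ and $p\in[1,2)$, and let $C_p([a,b],V)$ be the set of continuous paths $x:[a,b]\to V$ of finite $p$-variation. Let $T((V))=\prod_{k\ge 0}V^{\otimes k}$ be the algebra of formal tensor series with the product $(v\cdot w)_n=\sum_{l=0}^n v_l\otimes w_{n-l}$ and unit $\mathbf 1=(1,0,0,\dots)$. For $x\in C_p([a,b],V)$ and $a\le s\le t\le b$, let $S(x)_{[s,t]}\in T((V))$ be the signature, that is, the series with level $0$ equal to $1$ and level $k$ equal to the iterated Young integral $\int_{s<t_1<\dots<t_k<t}dx_{t_1}\otimes\cdots\otimes dx_{t_k}$. All integrals below are limits of left-point Riemann sums as the mesh of the partition tends to $0$. Let $(E,\|\cdot\|)$ be a real Banach algebra ($\|uv\|\le\|u\|\,\|v\|$) that is a subalgebra of $T((V))$ and contains $\mathcal S_p=\{S(x)_{[a,b]}:x\in C_p([a,b],V)\}$. Let $x\in C_p([a,b],V)$ and $A\in E$. Then $S(x)_{[a,t]}\in E$ for every $t\in[a,b]$, and the linear controlled differential equation $$dY_t=Y_t\cdot dx_t\ \text{ on }[a,b],\qquad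 Y_a=A,\qquad\text{i.e.}\qquad Y_t=A+\int_a^tY_u\cdot dx_u\quad(t\in[a,b]),$$ has a unique solution $Y:[a,b]\to E$, namely $Y_t=A\cdot S(x)_{[a,t]}$, in both of the following senses. 1. Level by level, i.e. with the integral taken in $T((V))$ with its product topology: $Y$ is a solution, each of its levels is in $C_p([a,b],V^{\otimes k})$, and it is the only $E$-valued solution. 2. If moreover $V=V^{\otimes 1}\subset E$, so that $Y_u\cdot dx_u$ takes values in $E$, in the Banach space $E$, with the integral converging in the norm of $E$: $Y$ belongs to $C_p([a,b],E)$ and is a solution, and it is the only solution among the norm-continuous paths in $E$ that have finite $q$-variation for some $q\ge 1$ with $1/p+1/q>1$. In particular, for $A=\mathbf 1$ the unique solution is the signature $t\mapsto S(x)_{[a,t]}$. -/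

import Mathlib

open Set Filter Topology PiTensorProduct
open scoped TensorProduct

noncomputable section

/-! ### The algebra `T((V))` of formal tensor series -/

/-- The product `∏_{k ≥ 0} V^{⊗k}` over `ℝ`, whose elements are the formal tensor series
`(v₀, v₁, v₂, …)` with `v_k ∈ V^{⊗k}`. -/
def TensorSeries (V : Type*) [NormedAddCommGroup V] [NormedSpace ℝ V] : Type _ :=
  ∀ k : ℕ, ⨂[ℝ]^k V

namespace TensorSeries

variable {V : Type*} [NormedAddCommGroup V] [NormedSpace ℝ V]

instance : AddCommGroup (TensorSeries V) :=
  inferInstanceAs (AddCommGroup (∀ k : ℕ, ⨂[ℝ]^k V))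

instance : Module ℝ (TensorSeries V) :=
  inferInstanceAs (Module ℝ (∀ k : ℕ, ⨂[ℝ]^k V))

/-- The product topology; each `V^{⊗k}` carries Mathlib's topology (that of the projective tensor
norm), which for finite-dimensional `V` is its usual vector space topology. -/
instance : TopologicalSpace (TensorSeries V) :=
  inferInstanceAs (TopologicalSpace (∀ k : ℕ, ⨂[ℝ]^k V))

/-- The concatenation product `V^{⊗i} × V^{⊗j} → V^{⊗(i+j)}`. -/
def levelMul {i j : ℕ} (v : ⨂[ℝ]^i V) (w : ⨂[ℝ]^j V) : ⨂[ℝ]^(i + j) V :=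
  GradedMonoid.GMul.mul (A := fun n : ℕ => ⨂[ℝ]^n V) v w

/-- The extended tensor product: `(v · w)_n = ∑_{l=0}^n v_l w_{n-l}`. The `cast` identifies
`V^{⊗(l+(n-l))}` with `V^{⊗n}`. -/
instance : Mul (TensorSeries V) :=
  ⟨fun v w n => ∑ l : Fin (n + 1),
    TensorPower.cast ℝ V (Nat.add_sub_of_le (Nat.lt_succ_iff.mp l.isLt))
      (levelMul (v l) (w (n - l)))⟩

/-- The inclusion `V^{⊗k} → T((V))`. -/
def incl (k : ℕ) (u : ⨂[ℝ]^k V) : TensorSeries V :=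
  Pi.single (M := fun n : ℕ => ⨂[ℝ]^n V) k u

/-- The unit `(1, 0, 0, …)`. -/
instance : One (TensorSeries V) :=
  ⟨incl 0 (tprod ℝ (Fin.elim0 : Fin 0 → V))⟩

/-- The inclusion `V = V^{⊗1} → T((V))`. -/
def ofVec (v : V) : TensorSeries V :=
  incl 1 (tprod ℝ (fun _ : Fin 1 => v))

theorem mul_apply (v w : TensorSeries V) (n : ℕ) :
    (v * w) n = ∑ l : Fin (n + 1),
      TensorPower.cast ℝ V (Nat.add_sub_of_le (Nat.lt_succ_iff.mp l.isLt))
        (levelMul (v l) (w (n - l))) := rfl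

@[ext] theorem ext {v w : TensorSeries V} (h : ∀ n, v n = w n) : v = w := funext h

theorem add_apply (v w : TensorSeries V) (n : ℕ) : (v + w) n = v n + w n := rfl

theorem smul_apply (r : ℝ) (v : TensorSeries V) (n : ℕ) : (r • v) n = r • v n := rfl

theorem zero_apply (n : ℕ) : (0 : TensorSeries V) n = 0 := rfl

theorem levelMul_eq {i j : ℕ} (v : ⨂[ℝ]^i V) (w : ⨂[ℝ]^j V) :
    levelMul v w = ((TensorProduct.mk ℝ _ _).compr₂
      (TensorPower.mulEquiv : _ ≃ₗ[ℝ] ⨂[ℝ]^(i + j) V).toLinearMap) v w := rfl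

/-- A finitely supported series, as an element of `T((V))`. -/
def ofDS (f : DirectSum ℕ fun n => ⨂[ℝ]^n V) : TensorSeries V := fun n => f n

theorem ofDS_of (i : ℕ) (u : ⨂[ℝ]^i V) :
    ofDS (DirectSum.of (fun n => ⨂[ℝ]^n V) i u) = incl i u := by
  funext n
  show (DirectSum.of (fun n => ⨂[ℝ]^n V) i u) n = incl i u n
  by_cases h : i = n
  · subst h; simp [incl]
  · rw [DirectSum.of_eq_of_ne _ _ _ (Ne.symm h)]
    simp [incl, Pi.single_eq_of_ne (Ne.symm h)]

theorem ofDS_add (f g : DirectSum ℕ fun n => ⨂[ℝ]^n V) :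
    ofDS (f + g) = ofDS f + ofDS g := by
  funext n; exact DirectSum.add_apply f g n

theorem ofDS_zero : ofDS (0 : DirectSum ℕ fun n => ⨂[ℝ]^n V) = 0 := rfl

protected theorem left_distrib' (u v w : TensorSeries V) : u * (v + w) = u * v + u * w := by
  ext n
  simp only [mul_apply, add_apply, levelMul_eq, map_add, Finset.sum_add_distrib]

protected theorem right_distrib' (u v w : TensorSeries V) : (u + v) * w = u * w + v * w := by
  ext n
  simp only [mul_apply, add_apply, levelMul_eq, map_add, LinearMap.add_apply,
    Finset.sum_add_distrib]

protected theorem zero_mul' (v : TensorSeries V) : 0 * v = 0 := by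
  ext n
  simp only [mul_apply, zero_apply, levelMul_eq, map_zero, LinearMap.zero_apply,
    Finset.sum_const_zero]

protected theorem mul_zero' (v : TensorSeries V) : v * 0 = 0 := by
  ext n
  simp only [mul_apply, zero_apply, levelMul_eq, map_zero, Finset.sum_const_zero]

protected theorem smul_mul' (r : ℝ) (v w : TensorSeries V) : (r • v) * w = r • (v * w) := by
  ext n
  simp only [mul_apply, smul_apply, levelMul_eq, map_smul, LinearMap.smul_apply,
    Finset.smul_sum]

protected theorem mul_smul' (r : ℝ) (v w : TensorSeries V) : v * (r • w) = r • (v * w) := by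
  ext n
  simp only [mul_apply, smul_apply, levelMul_eq, map_smul, Finset.smul_sum]

theorem incl_mul_incl {i j : ℕ} (u : ⨂[ℝ]^i V) (w : ⨂[ℝ]^j V) :
    incl i u * incl j w = incl (i + j) (levelMul u w) := by
  ext n
  rw [mul_apply]
  by_cases h : i + j = n
  · subst h
    rw [Finset.sum_eq_single (⟨i, by omega⟩ : Fin (i + j + 1))]
    · have e : i + j - i = j := by omega
      have key : ∀ (m : ℕ) (hm : m = j) (h' : i + m = i + j),
          TensorPower.cast ℝ V h' (levelMul (incl i u i) (incl j w m)) =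
            incl (i + j) (levelMul u w) (i + j) := by
        intro m hm h'
        subst hm
        simp [incl, TensorPower.cast_refl]
      exact key _ e _
    · intro l _ hl
      have hl' : (l : ℕ) ≠ i := fun h => hl (Fin.ext h)
      have : incl i u (l : ℕ) = 0 := Pi.single_eq_of_ne hl' _
      rw [this, levelMul_eq]; simp
    · simp
  · have h0 : incl (i + j) (levelMul u w) n = 0 := Pi.single_eq_of_ne (Ne.symm h) _
    rw [h0]
    refine Finset.sum_eq_zero fun l _ => ?_
    by_cases hl : (l : ℕ) = i
    · have hl2 : n - (l : ℕ) ≠ j := by have := l.isLt; omega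
      have : incl j w (n - (l : ℕ)) = 0 := Pi.single_eq_of_ne hl2 _
      rw [this, levelMul_eq]; simp
    · have : incl i u (l : ℕ) = 0 := Pi.single_eq_of_ne hl _
      rw [this, levelMul_eq]; simp

theorem ofDS_mul (f g : DirectSum ℕ fun n => ⨂[ℝ]^n V) :
    ofDS (f * g) = ofDS f * ofDS g := by
  induction f using DirectSum.induction_on with
  | zero => rw [zero_mul, ofDS_zero, TensorSeries.zero_mul']
  | add f₁ f₂ h₁ h₂ => rw [add_mul, ofDS_add, ofDS_add, h₁, h₂, TensorSeries.right_distrib']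
  | of i u =>
    induction g using DirectSum.induction_on with
    | zero => rw [mul_zero, ofDS_zero, TensorSeries.mul_zero']
    | add g₁ g₂ h₁ h₂ => rw [mul_add, ofDS_add, ofDS_add, h₁, h₂, TensorSeries.left_distrib']
    | of j w =>
      rw [DirectSum.of_mul_of, ofDS_of, ofDS_of, ofDS_of, incl_mul_incl]
      rfl

theorem ofDS_one : ofDS (1 : DirectSum ℕ fun n => ⨂[ℝ]^n V) = 1 :=
  ofDS_of 0 (tprod ℝ (Fin.elim0 : Fin 0 → V))

/-- The levels `0, …, N` of a series. -/
def trunc (N : ℕ) (v : TensorSeries V) : DirectSum ℕ fun n => ⨂[ℝ]^n V :=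
  ∑ i ∈ Finset.range (N + 1), DirectSum.of (fun n => ⨂[ℝ]^n V) i (v i)

theorem ofDS_trunc {N n : ℕ} (h : n ≤ N) (v : TensorSeries V) : ofDS (trunc N v) n = v n := by
  show (trunc N v) n = v n
  rw [trunc, DFinsupp.finsetSum_apply, Finset.sum_eq_single n]
  · exact DirectSum.of_eq_same _ _
  · intro i _ hi
    exact DirectSum.of_eq_of_ne _ _ _ (Ne.symm hi)
  · intro hn
    exact absurd (Finset.mem_range.mpr (by omega)) hn

theorem mul_congr {n : ℕ} {v v' w w' : TensorSeries V} (hv : ∀ k ≤ n, v k = v' k)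
    (hw : ∀ k ≤ n, w k = w' k) : ∀ k ≤ n, (v * w) k = (v' * w') k := by
  intro k hk
  rw [mul_apply, mul_apply]
  refine Finset.sum_congr rfl fun l _ => ?_
  have := l.isLt
  rw [hv l (by omega), hw (k - l) (by omega)]

instance : Ring (TensorSeries V) where
  __ := (inferInstance : AddCommGroup (TensorSeries V))
  left_distrib := TensorSeries.left_distrib'
  right_distrib := TensorSeries.right_distrib'
  zero_mul := TensorSeries.zero_mul'
  mul_zero := TensorSeries.mul_zero'
  mul_assoc u v w := by
    ext n
    have t : ∀ z : TensorSeries V, ∀ k ≤ n, z k = ofDS (trunc n z) k :=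
      fun z k hk => (ofDS_trunc hk z).symm
    rw [mul_congr (mul_congr (t u) (t v)) (t w) n le_rfl,
      mul_congr (t u) (mul_congr (t v) (t w)) n le_rfl,
      ← ofDS_mul, ← ofDS_mul, ← ofDS_mul, ← ofDS_mul, mul_assoc]
  one_mul v := by
    ext n
    have t : ∀ k ≤ n, v k = ofDS (trunc n v) k := fun k hk => (ofDS_trunc hk v).symm
    rw [mul_congr (fun _ _ => rfl) t n le_rfl, ← ofDS_one, ← ofDS_mul, one_mul, ← t n le_rfl]
  mul_one v := by
    ext n
    have t : ∀ k ≤ n, v k = ofDS (trunc n v) k := fun k hk => (ofDS_trunc hk v).symm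
    rw [mul_congr t (fun _ _ => rfl) n le_rfl, ← ofDS_one, ← ofDS_mul, mul_one, ← t n le_rfl]

instance : Algebra ℝ (TensorSeries V) :=
  Algebra.ofModule TensorSeries.smul_mul' TensorSeries.mul_smul'

end TensorSeries

/-! ### Partitions, `p`-variation, Young integrals -/

/-- A partition `s = u₀ < u₁ < ⋯ < u_n = t` of `[s, t]` (only `u₀, …, u_n` matter). For `s = t`
the only partition has `n = 0`. -/
structure IntervalPartition (s t : ℝ) where
  n : ℕ
  u : ℕ → ℝ
  u_zero : u 0 = s
  u_last : u n = t
  lt : ∀ i < n, u i < u (i + 1)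

/-- The filter "mesh tends to zero" on the partitions of `[s, t]`. -/
def meshFilter (s t : ℝ) : Filter (IntervalPartition s t) :=
  ⨅ δ ∈ Ioi (0 : ℝ), 𝓟 {D : IntervalPartition s t | ∀ i < D.n, D.u (i + 1) - D.u i < δ}

/-- `x` has finite `p`-variation on `[a, b]`. -/
def HasFiniteVariation {W : Type*} [SeminormedAddCommGroup W] (p : ℝ) (x : ℝ → W) (a b : ℝ) :
    Prop :=
  ∃ C : ℝ, ∀ D : IntervalPartition a b, ∑ i ∈ Finset.range D.n, ‖x (D.u (i + 1)) - x (D.u i)‖ ^ p ≤ C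

/-- `x`, restricted to `[a, b]`, belongs to `C_p([a, b], W)`: it is continuous and of finite
`p`-variation. -/
def MemCp {W : Type*} [SeminormedAddCommGroup W] (p : ℝ) (x : ℝ → W) (a b : ℝ) : Prop :=
  ContinuousOn x (Icc a b) ∧ HasFiniteVariation p x a b

/-- The Riemann sum `∑_i m (y_{u_i}) (x_{u_{i+1}} - x_{u_i})`, for a pairing `m` of the values of
the integrand with vectors of `V`. -/
def riemannSum {U V W : Type*} [AddCommGroup V] [AddCommMonoid W] (m : U → V → W) (y : ℝ → U)
    (x : ℝ → V) {s t : ℝ} (D : IntervalPartition s t) : W :=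
  ∑ i ∈ Finset.range D.n, m (y (D.u i)) (x (D.u (i + 1)) - x (D.u i))

/-- The Young integral `∫_s^t m(y_u) dx_u` exists and equals `I`: the Riemann sums converge to `I`
as the mesh tends to zero. -/
def HasYoungIntegral {U V W : Type*} [AddCommGroup V] [AddCommMonoid W] [TopologicalSpace W]
    (m : U → V → W) (y : ℝ → U) (x : ℝ → V) (s t : ℝ) (I : W) : Prop :=
  Tendsto (fun D : IntervalPartition s t => riemannSum m y x D) (meshFilter s t) (𝓝 I)

/-- The Young integral `∫_s^t m(y_u) dx_u` (an arbitrary value if it does not exist). -/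
def youngIntegral {U V W : Type*} [AddCommGroup V] [AddCommMonoid W] [TopologicalSpace W]
    (m : U → V → W) (y : ℝ → U) (x : ℝ → V) (s t : ℝ) : W :=
  @limUnder _ _ _ ⟨(0 : W)⟩ (meshFilter s t) (fun D : IntervalPartition s t => riemannSum m y x D)

/-! ### The signature -/

section Signature

variable {V : Type*} [NormedAddCommGroup V] [NormedSpace ℝ V]

/-- The iterated integral `∫_{s < t₁ < ⋯ < t_k < t} dx_{t₁} ⋯ dx_{t_k} ∈ V^{⊗k}`, as the iterated
Young integral `∫_s^t (∫_{s < t₁ < ⋯ < t_{k-1} < r} dx_{t₁} ⋯ dx_{t_{k-1}}) ⊗ dx_r`. -/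
def iteratedIntegral (x : ℝ → V) (s : ℝ) : (k : ℕ) → ℝ → ⨂[ℝ]^k V
  | 0, _ => tprod ℝ (Fin.elim0 : Fin 0 → V)
  | k + 1, t =>
    youngIntegral
      (fun (w : ⨂[ℝ]^k V) (v : V) => TensorSeries.levelMul w (tprod ℝ (fun _ : Fin 1 => v)))
      (fun r => iteratedIntegral x s k r) x s t

/-- The signature `S(x)_{[s,t]} ∈ T((V))`. -/
def signature (x : ℝ → V) (s t : ℝ) : TensorSeries V :=
  fun k => iteratedIntegral x s k t

/-- The range of the signature on `C_p([a, b], V)`. -/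
def signatureRange (V : Type*) [NormedAddCommGroup V] [NormedSpace ℝ V] (p a b : ℝ) :
    Set (TensorSeries V) :=
  {g | ∃ x : ℝ → V, MemCp p x a b ∧ signature x a b = g}

end Signature

/-! ### The controlled differential equation `dY = Y · dx` -/

section CDE

variable {V : Type*} [NormedAddCommGroup V] [NormedSpace ℝ V]

/-- `Y` solves `Y_t = A + ∫_a^t Y_u · dx_u` for `t ∈ [a, b]` in `T((V))`, level by level:
the integral is a limit of Riemann sums in the product topology. -/
def SolvesLevelwise (x : ℝ → V) (a b : ℝ) (A : TensorSeries V) (Y : ℝ → TensorSeries V) : Prop :=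
  ∀ t ∈ Icc a b,
    HasYoungIntegral (fun (y : TensorSeries V) (v : V) => y * TensorSeries.ofVec v) Y x a t
      (Y t - A)

/-- `Y` solves `Y_t = A + ∫_a^t Y_u · dx_u` for `t ∈ [a, b]` in a normed algebra `E` into which `V`
is mapped by `j`, as a Young equation driven by a path of finite `p`-variation: `Y` is a
norm-continuous path in `E` of finite `q`-variation for some `q ≥ 1` with `1/p + 1/q > 1`, and the
Riemann sums of the integral converge in the norm of `E`. -/
structure SolvesInNorm {E : Type*} [NormedRing E] [NormedAlgebra ℝ E] (j : V →ₗ[ℝ] E) (p : ℝ)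
    (x : ℝ → V) (a b : ℝ) (A : E) (Y : ℝ → E) : Prop where
  continuousOn : ContinuousOn Y (Icc a b)
  finiteVariation : ∃ q : ℝ, 1 ≤ q ∧ 1 < 1 / p + 1 / q ∧ HasFiniteVariation q Y a b
  integral_eq : ∀ t ∈ Icc a b, HasYoungIntegral (fun (y : E) (v : V) => y * j v) Y x a t (Y t - A)

/-- `Y` is the unique `E`-valued path on `[a, b]` that solves `dY = Y · dx`, `Y_a = A`, where
`ι : E → T((V))` is the inclusion: it is the unique solution level by level, with levels in
`C_p`, and, if `V ⊆ E` (so that the integral makes sense in `E`; `j` is then the inclusion of `V`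
into `E`), it is also the unique solution in the norm of `E`, and lies in `C_p([a, b], E)`. -/
structure IsUniqueSolution {E : Type*} [NormedRing E] [NormedAlgebra ℝ E]
    (ι : E →ₐ[ℝ] TensorSeries V) (p : ℝ) (x : ℝ → V) (a b : ℝ) (A : E) (Y : ℝ → E) : Prop where
  levelwise : SolvesLevelwise x a b (ι A) (fun t => ι (Y t))
  levelwise_memCp : ∀ k : ℕ, MemCp p (fun t => ι (Y t) k) a b
  levelwise_unique : ∀ Z : ℝ → E, SolvesLevelwise x a b (ι A) (fun t => ι (Z t)) →
    EqOn Z Y (Icc a b)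
  inNorm : ∀ j : V →ₗ[ℝ] E, (∀ v, ι (j v) = TensorSeries.ofVec v) → SolvesInNorm j p x a b A Y
  inNorm_memCp : ∀ j : V →ₗ[ℝ] E, (∀ v, ι (j v) = TensorSeries.ofVec v) → MemCp p Y a b
  inNorm_unique : ∀ j : V →ₗ[ℝ] E, (∀ v, ι (j v) = TensorSeries.ofVec v) →
    ∀ Z : ℝ → E, SolvesInNorm j p x a b A Z → EqOn Z Y (Icc a b)

end CDE

end

/-! The hard point is that the inclusion `ι` of `E` into `T((V))` is only an injective algebra
homomorphism: the norm of `E` need not control the product topology, so a limit taken in one space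
says nothing about the other. Both are therefore compared with a third space, `ℓ¹` of the words in
the letters of a basis of `V`. There the equation `dY = Y dx`, started at the empty word, has a
solution by Young theory. A continuous linear map `toSeries` sends it to `T((V))`, where it solves
the equation level by level from `1` and so is the signature. When `V ⊆ E` and the basis vectors
have norm at most `1` in `E`, evaluation of words is a continuous linear map `eval` to `E`. The
identity `ι ∘ eval = toSeries` is proved algebraically, by stripping first letters (`map_eval`), so
no continuity of `ι` is needed. Injectivity of `ι` then identifies the evaluated solution with the
signature, which is thereby continuous and of finite `p`-variation in norm. Left multiplication by
`A` gives the general initial value.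

The signature over `[a, t]` lies in `E` because it is the signature over `[a, b]` of the path
stopped at `t`.

Uniqueness level by level is triangular: level `n + 1` of a solution is an integral of level `n`.
Uniqueness in norm is a duality argument: if `R` solves `dR = -dx R` with `R b = 1`, then the
increments of `Z R` are of order greater than one for every solution `Z`, so `Z R` is constant and
`Z b = A R a`.

The analysis rests on the sewing lemma and Picard iteration for Hölder drivers. A path of finite
`p`-variation becomes Hölder of exponent `1 / p > 1 / 2` when time is measured by its own
`p`-variation, which is continuous in the endpoint. -/

/-! ### The sewing lemma -/

noncomputable section Sewing

variable {B : Type*} [NormedAddCommGroup B]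

/-- The constant of the sewing lemma. -/
def sewConst (θ : ℝ) : ℝ := 2 / (1 - 2 * (1 / 2 : ℝ) ^ θ)

theorem two_mul_half_rpow_lt_one {θ : ℝ} (hθ : 1 < θ) : 2 * (1 / 2 : ℝ) ^ θ < 1 := by
  have h := Real.rpow_lt_rpow_of_exponent_gt (x := (1 / 2 : ℝ)) (by norm_num) (by norm_num) hθ
  rw [Real.rpow_one] at h
  linarith

theorem sewConst_pos {θ : ℝ} (hθ : 1 < θ) : 0 < sewConst θ :=
  div_pos two_pos (sub_pos.2 (two_mul_half_rpow_lt_one hθ))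

/-- The fixed-point equation that closes the induction of `norm_sum_sub_le`: two halves, each
carrying the factor `(1 / 2) ^ θ`, and two defects of additivity. -/
theorem sewConst_eq {θ : ℝ} (hθ : 1 < θ) :
    sewConst θ = 2 * sewConst θ * (1 / 2 : ℝ) ^ θ + 2 := by
  have h := two_mul_half_rpow_lt_one hθ
  have h' : 1 - 2 * (1 / 2 : ℝ) ^ θ ≠ 0 := by linarith
  have : sewConst θ * (1 - 2 * (1 / 2 : ℝ) ^ θ) = 2 := div_mul_cancel₀ _ h'
  linarith

/-- The defect of additivity of `Ξ` on `[a, b]` is at most `K |v - u|^θ`. -/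
def AlmostAdditive (Ξ : ℝ → ℝ → B) (a b K θ : ℝ) : Prop :=
  ∀ u m v, a ≤ u → u ≤ m → m ≤ v → v ≤ b → ‖Ξ u v - Ξ u m - Ξ m v‖ ≤ K * (v - u) ^ θ

theorem AlmostAdditive.self_eq_zero {Ξ : ℝ → ℝ → B} {a b K θ : ℝ}
    (h : AlmostAdditive Ξ a b K θ) (hθ : 1 < θ) {u : ℝ} (hu : u ∈ Icc a b) : Ξ u u = 0 := by
  have := h u u u hu.1 le_rfl le_rfl hu.2
  rw [sub_self, sub_self, Real.zero_rpow (by linarith), mul_zero] at this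
  simpa using this

/-- Single out the step that crosses the midpoint of `[g 0, g n]`. The points before it and those
after it each span at most half the length, so induction applies to both sides; reassembling the
three pieces costs two defects. The bound is uniform in the number of points. -/
theorem AlmostAdditive.norm_sum_sub_le {Ξ : ℝ → ℝ → B} {a b K θ : ℝ}
    (h : AlmostAdditive Ξ a b K θ) (hK : 0 ≤ K) (hθ : 1 < θ) (n : ℕ) :
    ∀ g : ℕ → ℝ, Monotone g → (∀ i, g i ∈ Icc a b) →
      ‖∑ i ∈ Finset.range n, Ξ (g i) (g (i + 1)) - Ξ (g 0) (g n)‖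
        ≤ sewConst θ * K * (g n - g 0) ^ θ := by
  induction n using Nat.strong_induction_on with
  | _ n ih =>
  intro g hg hgi
  rcases Nat.eq_zero_or_pos n with rfl | hn
  · rw [Finset.sum_range_zero, h.self_eq_zero hθ (hgi 0), sub_self, sub_self, norm_zero,
      Real.zero_rpow (by linarith), mul_zero]
  set ω := g n - g 0 with hω
  have hω0 : 0 ≤ ω := sub_nonneg.2 (hg (Nat.zero_le n))
  -- The least such `i` gives the crossing step from `g i` to `g (i + 1)`: by minimality `g i` is
  -- still in the left half.
  have hex : ∃ i, g 0 + ω / 2 ≤ g (i + 1) := ⟨n - 1, by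
    rw [Nat.sub_add_cancel hn]; linarith⟩
  obtain ⟨i, hi1, hin, hi0⟩ : ∃ i, g 0 + ω / 2 ≤ g (i + 1) ∧ i + 1 ≤ n ∧ g i ≤ g 0 + ω / 2 := by
    classical
    refine ⟨Nat.find hex, Nat.find_spec hex, ?_, ?_⟩
    · have : Nat.find hex ≤ n - 1 := Nat.find_min' hex (by rw [Nat.sub_add_cancel hn]; linarith)
      omega
    · rcases Nat.eq_zero_or_pos (Nat.find hex) with h0 | h0
      · rw [h0]; linarith
      · have := Nat.find_min hex (m := Nat.find hex - 1) (by omega)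
        rw [Nat.sub_add_cancel h0] at this
        linarith
  clear hex
  clear_value ω
  obtain ⟨m, rfl⟩ := Nat.exists_eq_add_of_le hin
  have hl := ih i (by omega) g hg hgi
  have hr := ih m (by omega) (fun k => g (i + 1 + k)) (fun k l hkl => hg (by omega))
    (fun k => hgi _)
  simp only [add_zero] at hr
  have hθ0 : 0 ≤ θ := by linarith
  have hC : 0 ≤ sewConst θ * K := mul_nonneg (sewConst_pos hθ).le hK
  have half : ∀ r : ℝ, 0 ≤ r → r ≤ ω / 2 → r ^ θ ≤ (1 / 2 : ℝ) ^ θ * ω ^ θ := fun r h0 h1 => by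
    rw [← Real.mul_rpow (by norm_num) hω0]
    exact Real.rpow_le_rpow h0 (by linarith) hθ0
  have hl' := hl.trans (mul_le_mul_of_nonneg_left
    (half _ (sub_nonneg.2 (hg (Nat.zero_le i))) (by linarith)) hC)
  have hr' := hr.trans (mul_le_mul_of_nonneg_left
    (half _ (sub_nonneg.2 (hg (by omega))) (by rw [hω] at hi1 ⊢; linarith)) hC)
  have d1 := h (g 0) (g i) (g (i + 1)) (hgi 0).1 (hg (Nat.zero_le i)) (hg (by omega)) (hgi _).2
  have d2 := h (g 0) (g (i + 1)) (g (i + 1 + m)) (hgi 0).1 (hg (by omega)) (hg (by omega)) (hgi _).2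
  have d1' : ‖Ξ (g 0) (g (i + 1)) - Ξ (g 0) (g i) - Ξ (g i) (g (i + 1))‖ ≤ K * ω ^ θ :=
    d1.trans (mul_le_mul_of_nonneg_left (Real.rpow_le_rpow
      (sub_nonneg.2 (hg (by omega)))
      (hω ▸ sub_le_sub_right (hg (by omega)) _) hθ0) hK)
  have e : ∑ k ∈ Finset.range (i + 1 + m), Ξ (g k) (g (k + 1)) - Ξ (g 0) (g (i + 1 + m))
      = (∑ k ∈ Finset.range i, Ξ (g k) (g (k + 1)) - Ξ (g 0) (g i))
      + (∑ k ∈ Finset.range m, Ξ (g (i + 1 + k)) (g (i + 1 + (k + 1)))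
          - Ξ (g (i + 1)) (g (i + 1 + m)))
      - (Ξ (g 0) (g (i + 1)) - Ξ (g 0) (g i) - Ξ (g i) (g (i + 1)))
      - (Ξ (g 0) (g (i + 1 + m)) - Ξ (g 0) (g (i + 1)) - Ξ (g (i + 1)) (g (i + 1 + m))) := by
    rw [Finset.sum_range_add, Finset.sum_range_succ]
    simp only [add_assoc]
    abel
  rw [← hω] at d2
  rw [e]
  calc _ ≤ _ := (norm_sub_le _ _).trans (add_le_add ((norm_sub_le _ _).trans
        (add_le_add ((norm_add_le _ _).trans (add_le_add hl' hr')) d1')) d2)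
    _ = (2 * sewConst θ * (1 / 2 : ℝ) ^ θ + 2) * K * ω ^ θ := by ring
    _ = _ := by rw [← sewConst_eq hθ]

/-- The sum of `Ξ` over the `n`-th dyadic partition of `[a, b]`, restricted to `[u, v]`. -/
def dyadicSum (Ξ : ℝ → ℝ → B) (a b : ℝ) (n : ℕ) (u v : ℝ) : B :=
  ∑ k ∈ Finset.range (2 ^ n),
    Ξ (max u (min v (a + k * ((b - a) / 2 ^ n))))
      (max u (min v (a + (k + 1 : ℕ) * ((b - a) / 2 ^ n))))

/-- The limit of the dyadic sums of `Ξ` over `[a, t]`. -/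
def sew (Ξ : ℝ → ℝ → B) (a b t : ℝ) : B :=
  @limUnder _ _ _ ⟨(0 : B)⟩ atTop (fun n => dyadicSum Ξ a b n a t)

theorem clamp_mem {u v : ℝ} (huv : u ≤ v) (r : ℝ) : max u (min v r) ∈ Icc u v :=
  ⟨le_max_left _ _, max_le huv (min_le_left _ _)⟩

theorem clamp_sub_le {r s : ℝ} (h : r ≤ s) (u v : ℝ) :
    max u (min v s) - max u (min v r) ≤ s - r := by
  have h1 : min v s ≤ min v r + (s - r) := by
    rcases le_total v r with h' | h'
    · rw [min_eq_left h', min_eq_left (h'.trans h)]; linarith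
    · rw [min_eq_right h']; linarith [min_le_right v s]
  have : max u (min v s) ≤ max u (min v r) + (s - r) :=
    max_le (by linarith [le_max_left u (min v r)]) (by linarith [le_max_right u (min v r)])
  linarith

theorem clamp_mono (u v : ℝ) : Monotone fun r => max u (min v r) :=
  fun _ _ h => max_le_max le_rfl (min_le_min le_rfl h)

theorem two_pow_mul_div_rpow {L θ : ℝ} (hL : 0 ≤ L) (n : ℕ) :
    (2 : ℝ) ^ n * (L / 2 ^ n) ^ θ = L ^ θ * (2 * (1 / 2 : ℝ) ^ θ) ^ n := by
  rw [div_eq_mul_one_div, Real.mul_rpow hL (by positivity), mul_pow, ← one_div_pow,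
    Real.rpow_pow_comm (by norm_num)]
  ring

theorem sum_range_two_mul {M : Type*} [AddCommMonoid M] (f : ℕ → M) (m : ℕ) :
    ∑ i ∈ Finset.range (2 * m), f i = ∑ i ∈ Finset.range m, (f (2 * i) + f (2 * i + 1)) := by
  induction m with
  | zero => simp
  | succ m ih =>
    rw [Nat.mul_succ, Finset.sum_range_succ, Finset.sum_range_succ, ih, Finset.sum_range_succ,
      add_assoc]

/-- Halving each of the `2 ^ n` cells costs one defect per cell, of size `((b - a) / 2 ^ n) ^ θ`.
Since `θ > 1` the total decays geometrically. -/
theorem AlmostAdditive.norm_dyadicSum_succ_sub_le {Ξ : ℝ → ℝ → B} {a b K θ : ℝ}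
    (h : AlmostAdditive Ξ a b K θ) (hK : 0 ≤ K) (hθ : 1 < θ) {u v : ℝ} (hau : a ≤ u)
    (huv : u ≤ v) (hvb : v ≤ b) (n : ℕ) :
    ‖dyadicSum Ξ a b (n + 1) u v - dyadicSum Ξ a b n u v‖
      ≤ K * (b - a) ^ θ * (2 * (1 / 2 : ℝ) ^ θ) ^ n := by
  have hab : 0 ≤ b - a := by linarith
  have hs : 0 ≤ (b - a) / 2 ^ (n + 1) := by positivity
  rw [dyadicSum, pow_succ' 2 n, sum_range_two_mul, dyadicSum, ← Finset.sum_sub_distrib,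
    mul_assoc, ← two_pow_mul_div_rpow hab]
  refine (norm_sum_le_of_le (f := fun k => _) (n := fun _ => K * ((b - a) / 2 ^ n) ^ θ) _
    fun k _ => ?_).trans (le_of_eq ?_)
  · set s := (b - a) / 2 ^ (n + 1) with hsd
    have e2 : (b - a) / 2 ^ n = 2 * s := by rw [hsd, pow_succ]; field_simp
    have r0 : a + ((2 * k : ℕ) : ℝ) * s = a + k * (2 * s) := by push_cast; ring
    have r2 : a + ((2 * k + 1 + 1 : ℕ) : ℝ) * s = a + (k + 1 : ℕ) * (2 * s) := by push_cast; ring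
    have o1 : a + k * (2 * s) ≤ a + ((2 * k + 1 : ℕ) : ℝ) * s := by push_cast; linarith
    have o2 : a + ((2 * k + 1 : ℕ) : ℝ) * s ≤ a + (k + 1 : ℕ) * (2 * s) := by push_cast; linarith
    rw [r0, r2, e2, norm_sub_rev]
    have := h _ _ _ (hau.trans (clamp_mem huv _).1) (clamp_mono u v o1) (clamp_mono u v o2)
      ((clamp_mem huv _).2.trans hvb)
    rw [← sub_sub]
    refine this.trans (mul_le_mul_of_nonneg_left (Real.rpow_le_rpow ?_ ?_ (by linarith)) hK)
    · exact sub_nonneg.2 (clamp_mono u v (o1.trans o2))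
    · refine (clamp_sub_le (o1.trans o2) u v).trans (le_of_eq ?_)
      push_cast; ring
  · rw [Finset.sum_const, Finset.card_range, nsmul_eq_mul]
    push_cast; ring

/-- The dyadic sums become additive in the limit: a cell on one side of `u` contributes nothing, and
a cell across `u` contributes one defect. Bounding every cell by a defect is crude but still tends
to zero. -/
theorem AlmostAdditive.norm_dyadicSum_sub_sub_le {Ξ : ℝ → ℝ → B} {a b K θ : ℝ}
    (h : AlmostAdditive Ξ a b K θ) (hK : 0 ≤ K) (hθ : 1 < θ) {u v : ℝ} (hau : a ≤ u)
    (huv : u ≤ v) (hvb : v ≤ b) (n : ℕ) :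
    ‖dyadicSum Ξ a b n a v - dyadicSum Ξ a b n a u - dyadicSum Ξ a b n u v‖
      ≤ K * (b - a) ^ θ * (2 * (1 / 2 : ℝ) ^ θ) ^ n := by
  have hab : 0 ≤ b - a := by linarith
  rw [dyadicSum, dyadicSum, dyadicSum, ← Finset.sum_sub_distrib, ← Finset.sum_sub_distrib,
    mul_assoc, ← two_pow_mul_div_rpow hab]
  refine (norm_sum_le_of_le (f := fun k => _) (n := fun _ => K * ((b - a) / 2 ^ n) ^ θ) _
    fun k _ => ?_).trans (le_of_eq ?_)
  · set s := (b - a) / 2 ^ n with hsd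
    have hs : 0 ≤ s := by positivity
    set r := a + k * s with hr
    have hr' : a + (k + 1 : ℕ) * s = r + s := by push_cast; ring
    have har : a ≤ r := by rw [hr]; linarith [mul_nonneg (Nat.cast_nonneg (α := ℝ) k) hs]
    rw [hr']
    have hav := hau.trans huv
    have m1 : ∀ w q, a ≤ w → a ≤ q → max a (min w q) = min w q := fun w q h1 h2 =>
      max_eq_right (le_min h1 h2)
    rw [m1 v r hav har, m1 v _ hav (by linarith), m1 u r hau har, m1 u _ hau (by linarith)]
    have hpos : 0 ≤ K * s ^ θ := by positivity
    have z := fun w (hw : w ∈ Icc a b) => h.self_eq_zero hθ hw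
    rcases le_total (r + s) u with h1 | h1
    · rw [min_eq_right (show r ≤ v by linarith), min_eq_right (show r + s ≤ v by linarith),
        min_eq_right (show r ≤ u by linarith), min_eq_right h1, max_eq_left h1,
        max_eq_left (show r ≤ u by linarith), z u ⟨hau, huv.trans hvb⟩]
      simpa using hpos
    rcases le_total u r with h2 | h2
    · rw [min_eq_left h2, min_eq_left h1, max_eq_right (le_min huv h2),
        max_eq_right (le_min huv h1), z u ⟨hau, huv.trans hvb⟩]
      simpa using hpos
    · rw [min_eq_right h2, min_eq_left h1, min_eq_right (h2.trans huv), max_eq_left h2,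
        max_eq_right (le_min huv h1)]
      refine (h r u _ har h2 (le_min huv h1) ((min_le_left _ _).trans hvb)).trans
        (mul_le_mul_of_nonneg_left (Real.rpow_le_rpow ?_ ?_ (by linarith)) hK)
      · linarith [le_min huv h1]
      · linarith [min_le_right v (r + s)]
  · rw [Finset.sum_const, Finset.card_range, nsmul_eq_mul]
    push_cast; ring

theorem AlmostAdditive.norm_dyadicSum_sub_le {Ξ : ℝ → ℝ → B} {a b K θ : ℝ}
    (h : AlmostAdditive Ξ a b K θ) (hK : 0 ≤ K) (hθ : 1 < θ) {u v : ℝ} (hau : a ≤ u)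
    (huv : u ≤ v) (hvb : v ≤ b) (n : ℕ) :
    ‖dyadicSum Ξ a b n u v - Ξ u v‖ ≤ sewConst θ * K * (v - u) ^ θ := by
  have hab : 0 ≤ b - a := by linarith
  have hs : 0 ≤ (b - a) / 2 ^ n := by positivity
  have := h.norm_sum_sub_le hK hθ (2 ^ n)
    (fun k => max u (min v (a + k * ((b - a) / 2 ^ n))))
    (fun k l hkl => clamp_mono u v (by
      have : (k : ℝ) ≤ l := by exact_mod_cast hkl
      simpa using mul_le_mul_of_nonneg_right this hs))
    (fun k => ⟨hau.trans (clamp_mem huv _).1, (clamp_mem huv _).2.trans hvb⟩)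
  have e0 : max u (min v (a + ((0 : ℕ) : ℝ) * ((b - a) / 2 ^ n))) = u := by
    rw [Nat.cast_zero, zero_mul, add_zero]
    exact max_eq_left ((min_le_right _ _).trans hau)
  have e1 : max u (min v (a + ((2 ^ n : ℕ) : ℝ) * ((b - a) / 2 ^ n))) = v := by
    have : a + ((2 ^ n : ℕ) : ℝ) * ((b - a) / 2 ^ n) = b := by
      push_cast; field_simp; ring
    rw [this, min_eq_left hvb, max_eq_right huv]
  simp only [e0, e1] at this
  exact this

/-- The sewing lemma. -/
theorem AlmostAdditive.norm_sew_sub_le [CompleteSpace B] {Ξ : ℝ → ℝ → B} {a b K θ : ℝ}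
    (h : AlmostAdditive Ξ a b K θ) (hK : 0 ≤ K) (hθ : 1 < θ) {u v : ℝ} (hau : a ≤ u)
    (huv : u ≤ v) (hvb : v ≤ b) :
    ‖sew Ξ a b v - sew Ξ a b u - Ξ u v‖ ≤ sewConst θ * K * (v - u) ^ θ := by
  have hlim : ∀ t ∈ Icc a b,
      Tendsto (fun n => dyadicSum Ξ a b n a t) atTop (𝓝 (sew Ξ a b t)) := fun t ht => by
    refine CauchySeq.tendsto_limUnder (cauchySeq_of_le_geometric (2 * (1 / 2 : ℝ) ^ θ)
      (K * (b - a) ^ θ) (two_mul_half_rpow_lt_one hθ) fun n => ?_)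
    rw [dist_comm, dist_eq_norm]
    exact h.norm_dyadicSum_succ_sub_le hK hθ le_rfl ht.1 ht.2 n
  have hq : Tendsto (fun n => K * (b - a) ^ θ * (2 * (1 / 2 : ℝ) ^ θ) ^ n) atTop (𝓝 0) := by
    simpa using (tendsto_pow_atTop_nhds_zero_of_lt_one (by positivity)
      (two_mul_half_rpow_lt_one hθ)).const_mul (K * (b - a) ^ θ)
  have hl := (((hlim v ⟨hau.trans huv, hvb⟩).sub (hlim u ⟨hau, huv.trans hvb⟩)).sub_const
    (Ξ u v)).norm
  have hr := hq.add_const (sewConst θ * K * (v - u) ^ θ)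
  rw [zero_add] at hr
  refine le_of_tendsto_of_tendsto' hl hr fun n => ?_
  have e : dyadicSum Ξ a b n a v - dyadicSum Ξ a b n a u - Ξ u v
    = (dyadicSum Ξ a b n a v - dyadicSum Ξ a b n a u - dyadicSum Ξ a b n u v)
      + (dyadicSum Ξ a b n u v - Ξ u v) := by abel
  rw [e]
  exact (norm_add_le _ _).trans (add_le_add (h.norm_dyadicSum_sub_sub_le hK hθ hau huv hvb n)
    (h.norm_dyadicSum_sub_le hK hθ hau huv hvb n))

theorem AlmostAdditive.sew_left {Ξ : ℝ → ℝ → B} {a b K θ : ℝ}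
    (h : AlmostAdditive Ξ a b K θ) (hθ : 1 < θ) (hab : a ≤ b) : sew Ξ a b a = 0 := by
  have : ∀ n, dyadicSum Ξ a b n a a = 0 := fun n => Finset.sum_eq_zero fun k _ => by
    rw [max_eq_left (min_le_left _ _), max_eq_left (min_le_left _ _),
      h.self_eq_zero hθ ⟨le_rfl, hab⟩]
  simp only [sew, this]
  exact tendsto_const_nhds.limUnder_eq

end Sewing

/-! ### Linear equations driven by Hölder paths -/

noncomputable section LinearEquation

variable {B : Type*} [NormedAddCommGroup B] [NormedSpace ℝ B]

/-- `X` is Hölder continuous on `[a, b]` with constant `H` and exponent `α`. -/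
def HolderOnIcc {F : Type*} [NormedAddCommGroup F] (H α : ℝ) (X : ℝ → F) (a b : ℝ) : Prop :=
  ∀ u v, a ≤ u → u ≤ v → v ≤ b → ‖X v - X u‖ ≤ H * (v - u) ^ α

theorem HolderOnIcc.mono {F : Type*} [NormedAddCommGroup F] {H α a b a' b' : ℝ} {X : ℝ → F}
    (h : HolderOnIcc H α X a b) (ha : a ≤ a') (hb : b' ≤ b) : HolderOnIcc H α X a' b' :=
  fun u v h1 h2 h3 => h u v (ha.trans h1) h2 (h3.trans hb)

/-- `Y` is a Hölder solution on `[a, b]` of `dY = dX Y`, in terms of its increments. -/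
def IsHolderSolution (α : ℝ) (X : ℝ → B →L[ℝ] B) (Y : ℝ → B) (a b : ℝ) : Prop :=
  ∃ C, 0 ≤ C ∧ HolderOnIcc C α Y a b ∧ ∀ u v, a ≤ u → u ≤ v → v ≤ b →
    ‖Y v - Y u - (X v - X u) (Y u)‖ ≤ C * (v - u) ^ (2 * α)

theorem rpow_mul_rpow_le {α β r s t : ℝ} (hα : 0 ≤ α) (hβ : 0 ≤ β) (hr : 0 ≤ r) (hs : 0 ≤ s)
    (hrt : r ≤ t) (hst : s ≤ t) (h : 0 < α + β) : r ^ α * s ^ β ≤ t ^ (α + β) := by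
  rw [Real.rpow_add' (hr.trans hrt) h.ne']
  exact mul_le_mul (Real.rpow_le_rpow hr hrt hα) (Real.rpow_le_rpow hs hst hβ)
    (Real.rpow_nonneg hs _) (Real.rpow_nonneg (hr.trans hrt) _)

/-- By bilinearity the defect is exactly `-m (y r - y u) (X v - X r)`, a product of two Hölder
increments. -/
theorem almostAdditive_of_holder {U F W : Type*} [NormedAddCommGroup U] [NormedSpace ℝ U]
    [NormedAddCommGroup F] [NormedSpace ℝ F] [NormedAddCommGroup W] [NormedSpace ℝ W]
    (m : U →L[ℝ] F →L[ℝ] W) {y : ℝ → U} {X : ℝ → F} {a b c H α β : ℝ} (hα : 0 ≤ α) (hβ : 0 ≤ β)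
    (hαβ : 0 < α + β) (hc : 0 ≤ c) (hH : 0 ≤ H) (hy : HolderOnIcc c α y a b)
    (hX : HolderOnIcc H β X a b) :
    AlmostAdditive (fun u v => m (y u) (X v - X u)) a b (‖m‖ * c * H) (α + β) := by
  intro u r v hau hur hrv hvb
  have e : m (y u) (X v - X u) - m (y u) (X r - X u) - m (y r) (X v - X r)
      = -(m (y r - y u) (X v - X r)) := by
    simp only [map_sub, sub_apply]; abel
  rw [e, norm_neg]
  have h1 := hy u r hau hur (hrv.trans hvb)
  have h2 := hX r v (hau.trans hur) hrv hvb
  have h3 : (r - u) ^ α * (v - r) ^ β ≤ (v - u) ^ (α + β) :=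
    rpow_mul_rpow_le hα hβ (by linarith) (by linarith) (by linarith) (by linarith) hαβ
  calc _ ≤ ‖m‖ * ‖y r - y u‖ * ‖X v - X r‖ := m.le_opNorm₂ _ _
    _ ≤ ‖m‖ * (c * (r - u) ^ α) * (H * (v - r) ^ β) := by gcongr
    _ = ‖m‖ * c * H * ((r - u) ^ α * (v - r) ^ β) := by ring
    _ ≤ _ := by gcongr

/-- The integral `∫_a^t dX y`. -/
def opIntegral (X : ℝ → B →L[ℝ] B) (a b : ℝ) (y : ℝ → B) (t : ℝ) : B :=
  sew (fun u v => (X v - X u) (y u)) a b t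

theorem almostAdditive_op {X : ℝ → B →L[ℝ] B} {y : ℝ → B} {a b c H α : ℝ} (hα : 1 / 2 < α)
    (hc : 0 ≤ c) (hH : 0 ≤ H) (hX : HolderOnIcc H α X a b) (hy : HolderOnIcc c α y a b) :
    AlmostAdditive (fun u v => (X v - X u) (y u)) a b (c * H) (2 * α) := by
  intro u r v h1 h2 h3 h4
  have := almostAdditive_of_holder (ContinuousLinearMap.apply ℝ B : B →L[ℝ] (B →L[ℝ] B) →L[ℝ] B)
    (by linarith) (by linarith) (by linarith) hc hH hy hX u r v h1 h2 h3 h4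
  rw [two_mul]
  refine this.trans ?_
  have hn : ‖(ContinuousLinearMap.apply ℝ B : B →L[ℝ] (B →L[ℝ] B) →L[ℝ] B)‖ ≤ 1 :=
    ContinuousLinearMap.opNorm_le_bound _ zero_le_one fun x =>
      ContinuousLinearMap.opNorm_le_bound _ (by positivity) fun f => by
        simpa [mul_comm] using f.le_opNorm x
  have : 0 ≤ v - u := by linarith
  calc _ ≤ 1 * c * H * (v - u) ^ (α + α) := by gcongr
    _ = _ := by ring

/-- Across the junction the two local errors add up, together with the cross term `(X v - X c) (Y c
- Y u)`, which is itself of order `2 * α`; this is the `H * C` in the new constant. -/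
theorem IsHolderSolution.glue {X : ℝ → B →L[ℝ] B} {Y Z : ℝ → B} {a b c H α : ℝ} (hα : 1 / 2 < α)
    (hH : 0 ≤ H) (hX : HolderOnIcc H α X a b) (hac : a ≤ c)
    (hY : IsHolderSolution α X Y a c) (hZ : IsHolderSolution α X Z c b) (hYZ : Y c = Z c) :
    IsHolderSolution α X (fun t => if t ≤ c then Y t else Z t) a b := by
  obtain ⟨C, hC, hY1, hY2⟩ := hY
  obtain ⟨D, hD, hZ1, hZ2⟩ := hZ
  set M := D + C + H * C with hM
  have hHC : 0 ≤ H * C := by positivity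
  have hright : ∀ t, c ≤ t → (if t ≤ c then Y t else Z t) = Z t := fun t ht => by
    split_ifs with h
    · rw [le_antisymm h ht, hYZ]
    · rfl
  refine ⟨M, by positivity, fun u v hau huv hvb => ?_, fun u v hau huv hvb => ?_⟩
  · have hw : 0 ≤ (v - u) ^ α := Real.rpow_nonneg (by linarith) _
    rcases le_total v c with hv | hv
    · simp only [if_pos hv, if_pos (huv.trans hv)]
      refine (hY1 u v hau huv hv).trans ?_
      gcongr; linarith
    rcases le_total c u with hu | hu
    · simp only [hright u hu, hright v hv]
      refine (hZ1 u v hu huv hvb).trans ?_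
      gcongr; linarith
    · simp only [hright v hv, if_pos hu]
      have e : Z v - Y u = (Z v - Z c) + (Y c - Y u) := by rw [hYZ]; abel
      rw [e]
      calc _ ≤ D * (v - c) ^ α + C * (c - u) ^ α :=
            (norm_add_le _ _).trans (add_le_add (hZ1 c v le_rfl hv hvb) (hY1 u c hau hu le_rfl))
        _ ≤ D * (v - u) ^ α + C * (v - u) ^ α := by gcongr
        _ ≤ M * (v - u) ^ α := by rw [← add_mul]; gcongr; linarith
  · have hw : 0 ≤ (v - u) ^ (2 * α) := Real.rpow_nonneg (by linarith) _
    rcases le_total v c with hv | hv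
    · simp only [if_pos hv, if_pos (huv.trans hv)]
      refine (hY2 u v hau huv hv).trans ?_
      gcongr; linarith
    rcases le_total c u with hu | hu
    · simp only [hright u hu, hright v hv]
      refine (hZ2 u v hu huv hvb).trans ?_
      gcongr; linarith
    · simp only [hright v hv, if_pos hu]
      have e : Z v - Y u - (X v - X u) (Y u) = (Z v - Z c - (X v - X c) (Z c))
          + (Y c - Y u - (X c - X u) (Y u)) + (X v - X c) (Y c - Y u) := by
        rw [← hYZ]; simp only [map_sub, sub_apply]; abel
      rw [e]
      have h3 : ‖(X v - X c) (Y c - Y u)‖ ≤ H * C * (v - u) ^ (2 * α) := by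
        calc _ ≤ ‖X v - X c‖ * ‖Y c - Y u‖ := (X v - X c).le_opNorm _
          _ ≤ (H * (v - c) ^ α) * (C * (c - u) ^ α) :=
            mul_le_mul (hX c v hac hv hvb) (hY1 u c hau hu le_rfl) (norm_nonneg _)
              (mul_nonneg hH (Real.rpow_nonneg (by linarith) _))
          _ = H * C * ((v - c) ^ α * (c - u) ^ α) := by ring
          _ ≤ H * C * (v - u) ^ (2 * α) := by
            rw [two_mul]
            gcongr
            exact rpow_mul_rpow_le (by linarith) (by linarith) (by linarith) (by linarith)
              (by linarith) (by linarith) (by linarith)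
      calc _ ≤ D * (v - c) ^ (2 * α) + C * (c - u) ^ (2 * α) + H * C * (v - u) ^ (2 * α) :=
            (norm_add_le _ _).trans (add_le_add ((norm_add_le _ _).trans
              (add_le_add (hZ2 c v le_rfl hv hvb) (hY2 u c hau hu le_rfl))) h3)
        _ ≤ D * (v - u) ^ (2 * α) + C * (v - u) ^ (2 * α) + H * C * (v - u) ^ (2 * α) := by
          gcongr
        _ = _ := by rw [hM]; ring

variable [CompleteSpace B]

theorem norm_opIntegral_sub_le {X : ℝ → B →L[ℝ] B} {y : ℝ → B} {a b c H α : ℝ} (hα : 1 / 2 < α)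
    (hc : 0 ≤ c) (hH : 0 ≤ H) (hX : HolderOnIcc H α X a b) (hy : HolderOnIcc c α y a b)
    {u v : ℝ} (hau : a ≤ u) (huv : u ≤ v) (hvb : v ≤ b) :
    ‖opIntegral X a b y v - opIntegral X a b y u - (X v - X u) (y u)‖
      ≤ sewConst (2 * α) * (c * H) * (v - u) ^ (2 * α) :=
  (almostAdditive_op hα hc hH hX hy).norm_sew_sub_le (by positivity) (by linarith) hau huv hvb

/-- Picard iteration, written as the series of iterated integrals `I k`. On a short interval each
integration halves the Hölder constant, so the series and its local estimates converge
geometrically. The smallness condition does not involve `y₀`, because the equation is linear. -/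
theorem exists_isHolderSolution_of_small {X : ℝ → B →L[ℝ] B} {a b H α : ℝ} (hα : 1 / 2 < α)
    (hH : 0 ≤ H) (hX : HolderOnIcc H α X a b) (hab : a ≤ b)
    (hsmall : H * (1 + sewConst (2 * α)) * (b - a) ^ α ≤ 1 / 2) (y₀ : B) :
    ∃ Y, Y a = y₀ ∧ IsHolderSolution α X Y a b := by
  set S := sewConst (2 * α) with hS
  have hS0 : 0 < S := sewConst_pos (by linarith)
  obtain ⟨I, I0, Is⟩ : ∃ I : ℕ → ℝ → B, (∀ t, I 0 t = y₀) ∧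
      ∀ k, I (k + 1) = opIntegral X a b (I k) :=
    ⟨fun k => Nat.rec (fun _ => y₀) (fun _ y => opIntegral X a b y) k, fun _ => rfl, fun _ => rfl⟩
  set c := H * ‖y₀‖ with hc
  have hc0 : 0 ≤ c := by positivity
  have zero : HolderOnIcc 0 α (I 0) a b := fun u v _ _ _ => by simp [I0]
  have key : ∀ k, I (k + 1) a = 0 ∧ HolderOnIcc (c * (1 / 2) ^ k) α (I (k + 1)) a b := by
    intro k
    induction k with
    | zero =>
      refine ⟨?_, fun u v hau huv hvb => ?_⟩
      · rw [Is]
        exact (almostAdditive_op hα le_rfl hH hX zero).sew_left (by linarith) hab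
      · have h := norm_opIntegral_sub_le hα le_rfl hH hX zero hau huv hvb
        rw [zero_mul, mul_zero, zero_mul] at h
        have h' := sub_eq_zero.1 (norm_le_zero_iff.1 h)
        rw [Is, h', I0, pow_zero, mul_one]
        calc _ ≤ _ := (X v - X u).le_opNorm _
          _ ≤ H * (v - u) ^ α * ‖y₀‖ := by gcongr; exact hX u v hau huv hvb
          _ = _ := by rw [hc]; ring
    | succ k ih =>
      have hck : 0 ≤ c * (1 / 2 : ℝ) ^ k := by positivity
      refine ⟨?_, fun u v hau huv hvb => ?_⟩
      · rw [Is]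
        exact (almostAdditive_op hα hck hH hX ih.2).sew_left (by linarith) hab
      · have h := norm_opIntegral_sub_le hα hck hH hX ih.2 hau huv hvb
        rw [← Is] at h
        have hw : 0 ≤ v - u := by linarith
        have hIu : ‖I (k + 1) u‖ ≤ c * (1 / 2) ^ k * (b - a) ^ α := by
          have := ih.2 a u le_rfl hau (huv.trans hvb)
          rw [ih.1, sub_zero] at this
          refine this.trans ?_
          gcongr
          exact huv.trans hvb
        have h2 : (v - u) ^ (2 * α) ≤ (b - a) ^ α * (v - u) ^ α := by
          rw [two_mul, Real.rpow_add' hw (by linarith)]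
          gcongr
        have e : I (k + 1 + 1) v - I (k + 1 + 1) u =
            (I (k + 1 + 1) v - I (k + 1 + 1) u - (X v - X u) (I (k + 1) u))
              + (X v - X u) (I (k + 1) u) := by abel
        rw [e]
        calc _ ≤ S * (c * (1 / 2) ^ k * H) * (v - u) ^ (2 * α)
              + H * (v - u) ^ α * (c * (1 / 2) ^ k * (b - a) ^ α) :=
              (norm_add_le _ _).trans (add_le_add h (((X v - X u).le_opNorm _).trans
                (mul_le_mul (hX u v hau huv hvb) hIu (norm_nonneg _) (by positivity))))
          _ ≤ S * (c * (1 / 2) ^ k * H) * ((b - a) ^ α * (v - u) ^ α)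
              + H * (v - u) ^ α * (c * (1 / 2) ^ k * (b - a) ^ α) := by gcongr
          _ = (H * (1 + S) * (b - a) ^ α) * (c * (1 / 2) ^ k * (v - u) ^ α) := by ring
          _ ≤ 1 / 2 * (c * (1 / 2) ^ k * (v - u) ^ α) := by gcongr
          _ = _ := by rw [pow_succ]; ring
  have geo : Summable fun k : ℕ => (1 / 2 : ℝ) ^ k := summable_geometric_two
  have hsum : ∀ t ∈ Icc a b, HasSum (fun k => I k t) (∑' k, I k t) := fun t ht => by
    refine Summable.hasSum ((summable_nat_add_iff 1).1 ?_)
    refine Summable.of_norm_bounded (g := fun k => c * (b - a) ^ α * (1 / 2) ^ k)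
      (geo.mul_left _) fun k => ?_
    have := (key k).2 a t le_rfl ht.1 ht.2
    rw [(key k).1, sub_zero] at this
    refine this.trans ?_
    have : 0 ≤ t - a := sub_nonneg.2 ht.1
    calc _ ≤ c * (1 / 2) ^ k * (b - a) ^ α := by gcongr; exact ht.2
      _ = _ := by ring
  have hsum' : ∀ t ∈ Icc a b, HasSum (fun k => I (k + 1) t) ((∑' k, I k t) - y₀) :=
    fun t ht => by
      have := (hasSum_nat_add_iff' (f := fun k => I k t) 1).2 (hsum t ht)
      simpa [I0] using this
  have hgeo : ∀ r : ℝ, HasSum (fun k : ℕ => r * (1 / 2) ^ k) (r * 2) :=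
    fun r => hasSum_geometric_two.mul_left r
  -- The sums of the two geometric series. The second bound has an extra factor `2`: the error of `I
  -- (k + 1)` involves the Hölder constant of `I k`, hence a shift by one index.
  refine ⟨fun t => ∑' k, I k t, ?_, max (c * 2) (S * (c * H) * 4), le_max_of_le_left (by positivity),
    fun u v hau huv hvb => ?_, fun u v hau huv hvb => ?_⟩
  · have h1 := hsum' a ⟨le_rfl, hab⟩
    simp only [(key _).1] at h1
    exact sub_eq_zero.1 (h1.unique hasSum_zero)
  · have hu : u ∈ Icc a b := ⟨hau, huv.trans hvb⟩
    have hv : v ∈ Icc a b := ⟨hau.trans huv, hvb⟩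
    have hw : 0 ≤ (v - u) ^ α := Real.rpow_nonneg (by linarith) _
    have h := (hsum' v hv).sub (hsum' u hu)
    rw [sub_sub_sub_cancel_right] at h
    have := h.norm_le_of_bounded (hgeo (c * (v - u) ^ α)) fun k => by
      refine ((key k).2 u v hau huv hvb).trans (le_of_eq (by ring))
    refine this.trans ?_
    calc _ = c * 2 * (v - u) ^ α := by ring
      _ ≤ _ := by gcongr; exact le_max_left _ _
  · have hu : u ∈ Icc a b := ⟨hau, huv.trans hvb⟩
    have hv : v ∈ Icc a b := ⟨hau.trans huv, hvb⟩
    have hw : 0 ≤ (v - u) ^ (2 * α) := Real.rpow_nonneg (by linarith) _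
    have h := ((hsum' v hv).sub (hsum' u hu)).sub ((X v - X u).hasSum (hsum u hu))
    rw [sub_sub_sub_cancel_right] at h
    have h0 := h.norm_le_of_bounded (hgeo (2 * (S * (c * H)) * (v - u) ^ (2 * α))) fun k => by
      rw [Is]
      rcases k with _ | k
      · refine (norm_opIntegral_sub_le hα le_rfl hH hX zero hau huv hvb).trans ?_
        simp only [zero_mul, mul_zero, pow_zero, mul_one]
        positivity
      · refine (norm_opIntegral_sub_le hα (by positivity) hH hX (key k).2 hau huv hvb).trans
          (le_of_eq ?_)
        rw [← hS, pow_succ]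
        ring
    refine h0.trans ?_
    calc _ = S * (c * H) * 4 * (v - u) ^ (2 * α) := by ring
      _ ≤ _ := by gcongr; exact le_max_right _ _

/-- The admissible step length `ε` is the same for every initial value, so finitely many short
solutions, glued together, cover `[a, b]`. -/
theorem exists_isHolderSolution {X : ℝ → B →L[ℝ] B} {a b H α : ℝ} (hα : 1 / 2 < α)
    (hH : 0 ≤ H) (hX : HolderOnIcc H α X a b) (hab : a ≤ b) (y₀ : B) :
    ∃ Y, Y a = y₀ ∧ IsHolderSolution α X Y a b := by
  set S := sewConst (2 * α) with hS
  have hS0 : 0 < S := sewConst_pos (by linarith)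
  obtain ⟨ε, hε, hεs⟩ : ∃ ε : ℝ, 0 < ε ∧ H * (1 + S) * ε ^ α ≤ 1 / 2 := by
    have hD : 0 < 2 * (H * (1 + S) + 1) := by positivity
    -- The `+ 1` keeps the denominator positive when `H = 0`.
    refine ⟨(1 / (2 * (H * (1 + S) + 1))) ^ α⁻¹, by positivity, ?_⟩
    rw [Real.rpow_inv_rpow (by positivity) (by linarith), mul_one_div, div_le_iff₀ hD]
    linarith [mul_nonneg hH (by linarith : 0 ≤ 1 + S)]
  have main : ∀ n : ℕ, ∀ b', a ≤ b' → b' ≤ b → b' - a ≤ n * ε →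
      ∃ Y, Y a = y₀ ∧ IsHolderSolution α X Y a b' := by
    intro n
    induction n with
    | zero =>
      intro b' h1 h2 h3
      refine exists_isHolderSolution_of_small hα hH (hX.mono le_rfl h2) h1 ?_ y₀
      have : b' - a = 0 := by
        rw [Nat.cast_zero, zero_mul] at h3; linarith
      rw [this, Real.zero_rpow (by linarith)]
      norm_num
    | succ n ih =>
      intro b' h1 h2 h3
      set c := max a (b' - ε) with hc
      have hac : a ≤ c := le_max_left _ _
      have hcb : c ≤ b' := max_le h1 (by linarith)
      push_cast at h3
      obtain ⟨Y, hYa, hY⟩ := ih c hac (hcb.trans h2) (by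
        rw [sub_le_iff_le_add]
        exact max_le (by linarith [mul_nonneg (Nat.cast_nonneg (α := ℝ) n) hε.le]) (by linarith))
      have hw : b' - c ≤ ε := by linarith [le_max_right a (b' - ε)]
      obtain ⟨Z, hZc, hZ⟩ := exists_isHolderSolution_of_small hα hH (hX.mono hac h2) hcb (by
        refine le_trans ?_ hεs
        have : 0 ≤ b' - c := by linarith
        gcongr) (Y c)
      exact ⟨_, by simp [hac, hYa], hY.glue hα hH (hX.mono le_rfl h2) hac hZ hZc.symm⟩
  obtain ⟨n, hn⟩ := exists_nat_ge ((b - a) / ε)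
  exact main n b hab le_rfl ((div_le_iff₀ hε).1 hn)

/-- The equation `dY = -dX Y` with a terminal condition. -/
theorem exists_backward_isHolderSolution {X : ℝ → B →L[ℝ] B} {a b H α : ℝ} (hα : 1 / 2 < α)
    (hH : 0 ≤ H) (hX : HolderOnIcc H α X a b) (hab : a ≤ b) (y₀ : B) :
    ∃ Y, Y b = y₀ ∧ ∃ C, 0 ≤ C ∧ HolderOnIcc C α Y a b ∧ ∀ u v, a ≤ u → u ≤ v → v ≤ b →
      ‖Y v - Y u + (X v - X u) (Y v)‖ ≤ C * (v - u) ^ (2 * α) := by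
  -- Time reversal: the left endpoint of a reversed interval is the right endpoint of the original
  -- one, which is why `Y v` appears in the estimate.
  have hX' : HolderOnIcc H α (fun s => -X (-s)) (-b) (-a) := fun u v h1 h2 h3 => by
    have := hX (-v) (-u) (by linarith) (by linarith) (by linarith)
    rw [neg_sub_neg] at this ⊢
    exact this
  obtain ⟨Y, hY0, C, hC, hY1, hY2⟩ := exists_isHolderSolution hα hH hX' (neg_le_neg hab) y₀
  refine ⟨fun t => Y (-t), hY0, C, hC, fun u v h1 h2 h3 => ?_, fun u v h1 h2 h3 => ?_⟩
  · have := hY1 (-v) (-u) (by linarith) (by linarith) (by linarith)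
    rwa [neg_sub_neg, norm_sub_rev] at this
  · have := hY2 (-v) (-u) (by linarith) (by linarith) (by linarith)
    rw [neg_sub_neg, neg_neg, neg_neg, ← norm_neg, neg_sub_neg] at this
    refine le_of_eq_of_le ?_ this
    congr 1
    simp only [sub_apply]
    abel

end LinearEquation

/-! ### The variation of a path as a clock -/

noncomputable section Clock

namespace IntervalPartition

variable {s t r : ℝ}

theorem le_of_le (D : IntervalPartition s t) {i k : ℕ} (hik : i ≤ k) (hk : k ≤ D.n) :
    D.u i ≤ D.u k := by
  induction k, hik using Nat.le_induction with
  | base => exact le_rfl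
  | succ k _ ih => exact (ih (by omega)).trans (D.lt k (by omega)).le

theorem mem_Icc (D : IntervalPartition s t) {i : ℕ} (hi : i ≤ D.n) : D.u i ∈ Icc s t :=
  ⟨D.u_zero.symm.le.trans (D.le_of_le (Nat.zero_le i) hi), (D.le_of_le hi le_rfl).trans D.u_last.le⟩

/-- The trivial partition of `[s, s]`. -/
def point (s : ℝ) : IntervalPartition s s := ⟨0, fun _ => s, rfl, rfl, by simp⟩

/-- The partition of `[s, r]` that extends a partition of `[s, t]` by the interval `[t, r]`. -/
def snoc (D : IntervalPartition s t) (h : t < r) : IntervalPartition s r where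
  n := D.n + 1
  u i := if i ≤ D.n then D.u i else r
  u_zero := by simp [D.u_zero]
  u_last := by simp
  lt i hi := by
    rcases Nat.lt_succ_iff_lt_or_eq.1 hi with h' | rfl
    · rw [if_pos h'.le, if_pos (by omega)]; exact D.lt i h'
    · rw [if_pos le_rfl, if_neg (by omega), D.u_last]; exact h

/-- The `p`-variation sum of `x` over a partition. -/
def varSum {W : Type*} [SeminormedAddCommGroup W] (p : ℝ) (x : ℝ → W)
    (D : IntervalPartition s t) : ℝ :=
  ∑ i ∈ Finset.range D.n, ‖x (D.u (i + 1)) - x (D.u i)‖ ^ p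

variable {W : Type*} [SeminormedAddCommGroup W] {p : ℝ} {x : ℝ → W}

theorem varSum_snoc (D : IntervalPartition s t) (h : t < r) :
    (D.snoc h).varSum p x = D.varSum p x + ‖x r - x t‖ ^ p := by
  unfold varSum
  show ∑ i ∈ Finset.range (D.n + 1), _ = _
  rw [Finset.sum_range_succ]
  congr 1
  · refine Finset.sum_congr rfl fun i hi => ?_
    have := Finset.mem_range.1 hi
    simp only [snoc, if_pos this.le, if_pos (show i + 1 ≤ D.n by omega)]
  · simp [snoc, D.u_last]

theorem eq_or_exists_init (D : IntervalPartition s t) :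
    (s = t ∧ D.varSum p x = 0) ∨ ∃ r, r < t ∧ ∃ D' : IntervalPartition s r, D'.n < D.n ∧
      D.varSum p x = D'.varSum p x + ‖x t - x r‖ ^ p := by
  obtain ⟨n, u, u_zero, u_last, lt⟩ := D
  rcases n with _ | n
  · exact Or.inl ⟨u_zero.symm.trans u_last, by simp [varSum]⟩
  · refine Or.inr ⟨u n, u_last ▸ lt n (by omega),
      ⟨n, u, u_zero, rfl, fun i hi => lt i (by omega)⟩, Nat.lt_succ_self n, ?_⟩
    subst u_last
    rw [varSum, Finset.sum_range_succ]
    rfl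

theorem nonempty (h : s ≤ t) : Nonempty (IntervalPartition s t) := by
  rcases h.eq_or_lt with rfl | h
  · exact ⟨point s⟩
  · exact ⟨(point s).snoc h⟩

end IntervalPartition

theorem meshFilter_hasBasis (s t : ℝ) : (meshFilter s t).HasBasis (fun δ : ℝ => 0 < δ)
    fun δ => {D : IntervalPartition s t | ∀ i < D.n, D.u (i + 1) - D.u i < δ} :=
  hasBasis_biInf_principal
    (fun δ hδ ε hε => ⟨min δ ε, lt_min (mem_Ioi.1 hδ) (mem_Ioi.1 hε),
      fun _ hD i hi => (hD i hi).trans_le (min_le_left _ _),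
      fun _ hD i hi => (hD i hi).trans_le (min_le_right _ _)⟩) ⟨1, mem_Ioi.2 one_pos⟩

theorem meshFilter_neBot {s t : ℝ} (h : s ≤ t) : (meshFilter s t).NeBot := by
  refine (meshFilter_hasBasis s t).neBot_iff.2 fun {δ} hδ => ?_
  rcases h.eq_or_lt with rfl | h
  · exact ⟨IntervalPartition.point s, fun i hi => absurd hi (Nat.not_lt_zero i)⟩
  · obtain ⟨n, hn⟩ := exists_nat_gt ((t - s) / δ)
    have hts : 0 < t - s := sub_pos.2 h
    have hn0 : (0 : ℝ) < n := (div_pos hts hδ).trans hn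
    have hstep : ∀ i : ℕ, s + (i + 1 : ℕ) * ((t - s) / n) - (s + i * ((t - s) / n))
        = (t - s) / n := fun i => by push_cast; ring
    refine ⟨⟨n, fun i => s + i * ((t - s) / n), by simp, by field_simp; ring, fun i _ => ?_⟩,
      fun i _ => ?_⟩
    · rw [← sub_pos, hstep]; positivity
    · rw [hstep, div_lt_iff₀ hn0, mul_comm]
      exact (div_lt_iff₀ hδ).1 hn

/-- The `p`-variation of `x` on `[a, t]`, to the power `p`. -/
def pVar {W : Type*} [SeminormedAddCommGroup W] (p : ℝ) (x : ℝ → W) (a t : ℝ) : ℝ :=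
  ⨆ D : IntervalPartition a t, D.varSum p x

section pVar

variable {W : Type*} [SeminormedAddCommGroup W] {p : ℝ} {x : ℝ → W} {a b : ℝ}

theorem HasFiniteVariation.bddAbove (hx : HasFiniteVariation p x a b) {t : ℝ} (ht : t ≤ b) :
    BddAbove (range fun D : IntervalPartition a t => D.varSum p x) := by
  obtain ⟨C, hC⟩ := hx
  refine ⟨C, ?_⟩
  rintro _ ⟨D, rfl⟩
  rcases ht.eq_or_lt with rfl | ht
  · exact hC D
  · have h1 : (D.snoc ht).varSum p x ≤ C := hC _
    rw [IntervalPartition.varSum_snoc] at h1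
    have : 0 ≤ ‖x b - x t‖ ^ p := Real.rpow_nonneg (norm_nonneg _) _
    show D.varSum p x ≤ C
    linarith

theorem HasFiniteVariation.varSum_le_pVar (hx : HasFiniteVariation p x a b) {t : ℝ} (ht : t ≤ b)
    (D : IntervalPartition a t) : D.varSum p x ≤ pVar p x a t :=
  le_ciSup (hx.bddAbove ht) D

theorem exists_lt_varSum {t ε : ℝ} (hat : a ≤ t) (hε : 0 < ε) :
    ∃ D : IntervalPartition a t, pVar p x a t - ε < D.varSum p x :=
  have := IntervalPartition.nonempty hat
  exists_lt_of_lt_ciSup (sub_lt_self _ hε)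

theorem HasFiniteVariation.pVar_add_le (hx : HasFiniteVariation p x a b) {u v : ℝ} (hau : a ≤ u)
    (huv : u < v) (hvb : v ≤ b) : pVar p x a u + ‖x v - x u‖ ^ p ≤ pVar p x a v := by
  have := IntervalPartition.nonempty hau
  rw [← le_sub_iff_add_le]
  refine ciSup_le fun D => ?_
  rw [le_sub_iff_add_le, ← IntervalPartition.varSum_snoc D huv]
  exact hx.varSum_le_pVar hvb _

theorem HasFiniteVariation.pVar_mono (hx : HasFiniteVariation p x a b) {u v : ℝ} (hau : a ≤ u)
    (huv : u ≤ v) (hvb : v ≤ b) : pVar p x a u ≤ pVar p x a v := by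
  rcases huv.eq_or_lt with rfl | h
  · exact le_rfl
  · have : 0 ≤ ‖x v - x u‖ ^ p := Real.rpow_nonneg (norm_nonneg _) _
    linarith [hx.pVar_add_le hau h hvb]

/-- In a nearly optimal partition of `[a, t]`, move the last point from `t` to a nearby `s`; only
the last term changes, and continuously. -/
theorem MemCp.pVar_left (hp : 0 < p) (hx : MemCp p x a b) {t ε : ℝ} (ht : t ∈ Icc a b)
    (hε : 0 < ε) : ∃ δ > 0, ∀ s, a ≤ s → s ≤ t → t - s < δ → pVar p x a t - ε < pVar p x a s := by
  obtain ⟨D, hD⟩ := exists_lt_varSum (p := p) (x := x) ht.1 (half_pos hε)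
  rcases D.eq_or_exists_init (p := p) (x := x) with ⟨rfl, _⟩ | ⟨r, hrt, D', _, hD'⟩
  · refine ⟨1, one_pos, fun s h1 h2 _ => ?_⟩
    rw [le_antisymm h2 h1]; linarith
  · have hc : ContinuousWithinAt (fun s => ‖x s - x r‖ ^ p) (Icc a b) t :=
      ((hx.1 t ht).sub_const _).norm.rpow_const (Or.inr hp.le)
    have hev := hc.eventually (lt_mem_nhds (sub_lt_self (‖x t - x r‖ ^ p) (half_pos hε)))
    obtain ⟨δ, hδ, hball⟩ := Metric.mem_nhdsWithin_iff.1 hev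
    refine ⟨min δ (t - r), lt_min hδ (by linarith), fun s h1 h2 h3 => ?_⟩
    have h4 : ‖x t - x r‖ ^ p - ε / 2 < ‖x s - x r‖ ^ p := hball ⟨by
      rw [Metric.mem_ball, Real.dist_eq, abs_sub_comm, abs_of_nonneg (by linarith)]
      exact h3.trans_le (min_le_left _ _), h1, h2.trans ht.2⟩
    have hrs : r < s := by linarith [min_le_right δ (t - r)]
    have h5 := hx.2.varSum_le_pVar (h2.trans ht.2) (D'.snoc hrs)
    rw [IntervalPartition.varSum_snoc] at h5
    linarith

/-- A partition of `[a, s]` with `t < s` has one interval `[r, w]` with `r ≤ t < w`. Here `c` is the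
sum before `r`, and everything after `w` is absorbed in the variation gained from `w` to `s`. -/
theorem HasFiniteVariation.varSum_le_crossing (hp : 0 < p)
    (hx : HasFiniteVariation p x a b) {t : ℝ}
    (hat : a ≤ t) (n : ℕ) : ∀ s, t < s → s ≤ b → ∀ D : IntervalPartition a s, D.n ≤ n →
      ∃ w r c, t < w ∧ w ≤ s ∧ a ≤ r ∧ r ≤ t ∧ c + ‖x t - x r‖ ^ p ≤ pVar p x a t ∧
        D.varSum p x ≤ c + ‖x w - x r‖ ^ p + (pVar p x a s - pVar p x a w) := by
  induction n with
  | zero =>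
    intro s hts _ D hD
    rcases D.eq_or_exists_init (p := p) (x := x) with ⟨rfl, _⟩ | ⟨_, _, D', h, _⟩
    · linarith
    · omega
  | succ n ih =>
    intro s hts hsb D hD
    rcases D.eq_or_exists_init (p := p) (x := x) with ⟨rfl, _⟩ | ⟨r, hrs, D', hn, hsum⟩
    · linarith
    rcases lt_or_ge t r with htr | hrt
    · obtain ⟨w, r', c, h1, h2, h3, h4, h5, h6⟩ := ih r htr (hrs.le.trans hsb) D' (by omega)
      refine ⟨w, r', c, h1, h2.trans hrs.le, h3, h4, h5, ?_⟩
      linarith [hx.pVar_add_le (hat.trans htr.le) hrs hsb]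
    · have har : a ≤ r := D'.u_zero ▸ (D'.mem_Icc (Nat.zero_le _)).2
      refine ⟨s, r, D'.varSum p x, hts, le_rfl, har, hrt, ?_, by linarith⟩
      have h7 := hx.varSum_le_pVar (hrs.le.trans hsb) D'
      rcases hrt.eq_or_lt with rfl | hrt
      · rwa [sub_self, norm_zero, Real.zero_rpow hp.ne', add_zero]
      · linarith [hx.pVar_add_le har hrt (hts.le.trans hsb)]

/-- If the variation jumped by `ε` just after `t`, take a nearly optimal partition of `[a, s]` with
`s` close to `t`. Moving the right end `w` of its crossing interval back to `t` costs less than `ε /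
4`, while the part after `w` misses the jump; the sum falls too far below the supremum. -/
theorem MemCp.pVar_right (hp : 0 < p) (hx : MemCp p x a b) {t ε : ℝ} (ht : t ∈ Icc a b)
    (hε : 0 < ε) : ∃ δ > 0, ∀ s, t ≤ s → s ≤ b → s - t < δ → pVar p x a s < pVar p x a t + ε := by
  rcases ht.2.eq_or_lt with rfl | htb
  · exact ⟨1, one_pos, fun s h1 h2 _ => by rw [le_antisymm h2 h1]; linarith⟩
  -- By monotonicity one such `s` serves for all points between `t` and `s`.
  suffices ∃ s, t < s ∧ s ≤ b ∧ pVar p x a s < pVar p x a t + ε by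
    obtain ⟨s, h1, h2, h3⟩ := this
    exact ⟨s - t, by linarith, fun s' h4 h5 h6 =>
      (hx.2.pVar_mono (ht.1.trans h4) (by linarith) h2).trans_lt h3⟩
  by_contra! hcon
  have hcont : ContinuousOn (fun z : ℝ × ℝ => ‖x z.1 - x z.2‖ ^ p) (Icc a b ×ˢ Icc a b) :=
    ((hx.1.comp continuousOn_fst fun z hz => hz.1).sub
      (hx.1.comp continuousOn_snd fun z hz => hz.2)).norm.rpow_const fun _ _ => Or.inr hp.le
  have huc := (isCompact_Icc.prod isCompact_Icc).uniformContinuousOn_of_continuous hcont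
  obtain ⟨δ, hδ, hδ'⟩ := Metric.uniformContinuousOn_iff.1 huc (ε / 4) (by linarith)
  set s := min b (t + δ / 2) with hs
  have hts : t < s := lt_min htb (by linarith)
  have hsb : s ≤ b := min_le_left _ _
  obtain ⟨D, hD⟩ := exists_lt_varSum (p := p) (x := x) (a := a) (t := s) (ε := ε / 4)
    (ht.1.trans hts.le) (by linarith)
  obtain ⟨w, r, c, h1, h2, h3, h4, h5, h6⟩ :=
    hx.2.varSum_le_crossing hp ht.1 D.n s hts hsb D le_rfl
  have h7 := hcon w h1 (h2.trans hsb)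
  have h8 := hδ' (w, r) ⟨⟨ht.1.trans h1.le, h2.trans hsb⟩, h3, h4.trans ht.2⟩ (t, r)
    ⟨ht, h3, h4.trans ht.2⟩ (by
      rw [Prod.dist_eq, dist_self, Real.dist_eq, abs_of_nonneg (by linarith)]
      exact max_lt (by linarith [min_le_right b (t + δ / 2)]) hδ)
  rw [Real.dist_eq] at h8
  have h9 := (abs_lt.1 h8).2
  dsimp only at h9
  linarith

theorem MemCp.continuousOn_pVar (hp : 0 < p) (hx : MemCp p x a b) :
    ContinuousOn (pVar p x a) (Icc a b) := by
  intro t ht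
  rw [Metric.continuousWithinAt_iff]
  intro ε hε
  obtain ⟨δ₁, h1, hl⟩ := hx.pVar_left hp ht hε
  obtain ⟨δ₂, h2, hr⟩ := hx.pVar_right hp ht hε
  refine ⟨min δ₁ δ₂, lt_min h1 h2, fun s hs hst => ?_⟩
  rw [Real.dist_eq] at hst ⊢
  rw [abs_lt] at hst ⊢
  rcases le_total s t with h | h
  · have := hl s hs.1 h (by linarith [min_le_left δ₁ δ₂])
    have := hx.2.pVar_mono hs.1 h ht.2
    constructor <;> linarith
  · have := hr s h hs.2 (by linarith [min_le_right δ₁ δ₂])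
    have := hx.2.pVar_mono ht.1 h hs.2
    constructor <;> linarith

end pVar

/-- `φ` is a continuous strictly increasing function on `[a, b]`. -/
structure IsClock (φ : ℝ → ℝ) (a b : ℝ) : Prop where
  strictMonoOn : StrictMonoOn φ (Icc a b)
  continuousOn : ContinuousOn φ (Icc a b)

/-- `x` has increments at most `H (φ v - φ u)^α` on `[a, b]`. -/
def ClockBound {W : Type*} [SeminormedAddCommGroup W] (φ : ℝ → ℝ) (H α : ℝ) (x : ℝ → W)
    (a b : ℝ) : Prop :=
  ∀ u v, a ≤ u → u ≤ v → v ≤ b → ‖x v - x u‖ ≤ H * (φ v - φ u) ^ α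

theorem IsClock.le {φ : ℝ → ℝ} {a b u v : ℝ} (hφ : IsClock φ a b) (hau : a ≤ u) (huv : u ≤ v)
    (hvb : v ≤ b) : φ u ≤ φ v :=
  hφ.strictMonoOn.monotoneOn ⟨hau, huv.trans hvb⟩ ⟨hau.trans huv, hvb⟩ huv

theorem IsClock.add {φ ψ : ℝ → ℝ} {a b : ℝ} (h : IsClock φ a b) (h' : IsClock ψ a b) :
    IsClock (fun t => φ t + ψ t) a b :=
  ⟨h.1.add h'.1, h.2.add h'.2⟩

/-- The clock is the `p`-variation plus `t`; the summand `t` makes it strictly increasing where the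
path is constant. -/
theorem MemCp.exists_clock {W : Type*} [SeminormedAddCommGroup W] {p : ℝ} {x : ℝ → W} {a b : ℝ}
    (hp : 0 < p) (hx : MemCp p x a b) : ∃ φ, IsClock φ a b ∧ ClockBound φ 1 (1 / p) x a b := by
  refine ⟨fun t => pVar p x a t + t, ⟨fun u hu v hv huv => ?_,
    (hx.continuousOn_pVar hp).add continuousOn_id⟩, fun u v hau huv hvb => ?_⟩
  · exact add_lt_add_of_le_of_lt (hx.2.pVar_mono hu.1 huv.le hv.2) huv
  · rcases huv.eq_or_lt with rfl | huv
    · simp only [sub_self, norm_zero, one_mul]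
      exact Real.rpow_nonneg le_rfl _
    · have h := hx.2.pVar_add_le hau huv hvb
      rw [one_mul, one_div, Real.le_rpow_inv_iff_of_pos (norm_nonneg _) (by
        linarith [hx.2.pVar_mono hau huv.le hvb]) hp]
      linarith

theorem IsClock.memCp {W : Type*} [SeminormedAddCommGroup W] {φ : ℝ → ℝ} {p H : ℝ} {x : ℝ → W}
    {a b : ℝ} (hφ : IsClock φ a b) (hp : 0 < p) (hH : 0 ≤ H)
    (hx : ClockBound φ H (1 / p) x a b) : MemCp p x a b := by
  constructor
  · intro t ht
    rw [ContinuousWithinAt, tendsto_iff_norm_sub_tendsto_zero]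
    have h0 : Tendsto (fun s => H * |φ s - φ t| ^ (1 / p)) (𝓝[Icc a b] t) (𝓝 0) := by
      have h1 : ContinuousWithinAt (fun s => H * |φ s - φ t| ^ (1 / p)) (Icc a b) t :=
        ((((hφ.continuousOn t ht).sub_const _).abs).rpow_const
          (Or.inr (by positivity))).const_mul H
      have h2 : H * |φ t - φ t| ^ (1 / p) = 0 := by
        rw [sub_self, abs_zero, Real.zero_rpow (by positivity), mul_zero]
      simpa only [ContinuousWithinAt, h2] using h1
    refine squeeze_zero' (Eventually.of_forall fun _ => norm_nonneg _) ?_ h0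
    filter_upwards [self_mem_nhdsWithin] with s hs
    rcases le_total s t with h | h
    · rw [norm_sub_rev, abs_sub_comm, abs_of_nonneg (sub_nonneg.2 (hφ.le hs.1 h ht.2))]
      exact hx s t hs.1 h ht.2
    · rw [abs_of_nonneg (sub_nonneg.2 (hφ.le ht.1 h hs.2))]
      exact hx t s ht.1 h hs.2
  · refine ⟨H ^ p * (φ b - φ a), fun D => ?_⟩
    have hb : φ b - φ a = ∑ i ∈ Finset.range D.n, (φ (D.u (i + 1)) - φ (D.u i)) := by
      rw [Finset.sum_range_sub (fun i => φ (D.u i)), D.u_last, D.u_zero]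
    rw [hb, Finset.mul_sum]
    refine Finset.sum_le_sum fun i hi => ?_
    have hi' := Finset.mem_range.1 hi
    have h1 := D.mem_Icc hi'.le
    have h2 := D.mem_Icc (Nat.succ_le_of_lt hi')
    have h0 := sub_nonneg.2 (hφ.le h1.1 (D.lt i hi').le h2.2)
    calc _ ≤ (H * (φ (D.u (i + 1)) - φ (D.u i)) ^ (1 / p)) ^ p :=
          Real.rpow_le_rpow (norm_nonneg _) (hx _ _ h1.1 (D.lt i hi').le h2.2) hp.le
      _ = _ := by
        rw [Real.mul_rpow hH (Real.rpow_nonneg h0 _), ← Real.rpow_mul h0,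
          one_div_mul_cancel hp.ne', Real.rpow_one]

/-- Local errors of order `θ > 1` add up to at most `C * η ^ (θ - 1)` times the total clock time,
where `η` bounds the clock increments and is small with the mesh. With `m = 0` this says that a path
whose increments have order greater than one is constant. -/
theorem hasYoungIntegral_of_local {U V W : Type*} [AddCommGroup V] [SeminormedAddCommGroup W]
    {m : U → V → W} {y : ℝ → U} {x : ℝ → V} {F : ℝ → W} {φ : ℝ → ℝ} {a b C θ : ℝ}
    (hφ : IsClock φ a b) (hθ : 1 < θ) (hC : 0 ≤ C)
    (h : ∀ u v, a ≤ u → u ≤ v → v ≤ b → ‖F v - F u - m (y u) (x v - x u)‖ ≤ C * (φ v - φ u) ^ θ)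
    {t : ℝ} (ht : t ∈ Icc a b) : HasYoungIntegral m y x a t (F t - F a) := by
  rw [HasYoungIntegral, (meshFilter_hasBasis a t).tendsto_iff Metric.nhds_basis_ball]
  intro ε hε
  set L := φ t - φ a with hL
  have hL0 : 0 ≤ L := sub_nonneg.2 (hφ.le le_rfl ht.1 ht.2)
  obtain ⟨η, hη, hηε⟩ : ∃ η : ℝ, 0 < η ∧ C * η ^ (θ - 1) * L < ε := by
    have hc : Tendsto (fun η : ℝ => C * η ^ (θ - 1) * L) (𝓝[>] 0) (𝓝 0) := by
      have h1 : ContinuousAt (fun η : ℝ => C * η ^ (θ - 1) * L) 0 :=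
        ((Real.continuousAt_rpow_const 0 (θ - 1) (Or.inr (by linarith))).const_mul C).mul_const L
      have h2 : C * (0 : ℝ) ^ (θ - 1) * L = 0 := by
        rw [Real.zero_rpow (by linarith), mul_zero, zero_mul]
      have h3 := h1.tendsto.mono_left (nhdsWithin_le_nhds (s := Ioi 0))
      rwa [h2] at h3
    obtain ⟨η, h1, h2⟩ := ((hc.eventually (gt_mem_nhds hε)).and self_mem_nhdsWithin).exists
    exact ⟨η, h2, h1⟩
  obtain ⟨δ, hδ, hδ'⟩ := Metric.uniformContinuousOn_iff.1
    (isCompact_Icc.uniformContinuousOn_of_continuous hφ.continuousOn) η hη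
  refine ⟨δ, hδ, fun D hD => ?_⟩
  rw [Metric.mem_ball, dist_comm, dist_eq_norm]
  have e1 : F t - F a = ∑ i ∈ Finset.range D.n, (F (D.u (i + 1)) - F (D.u i)) := by
    rw [Finset.sum_range_sub (fun i => F (D.u i)), D.u_last, D.u_zero]
  have e2 : L = ∑ i ∈ Finset.range D.n, (φ (D.u (i + 1)) - φ (D.u i)) := by
    rw [Finset.sum_range_sub (fun i => φ (D.u i)), D.u_last, D.u_zero]
  rw [e1, riemannSum, ← Finset.sum_sub_distrib]
  refine lt_of_le_of_lt ?_ hηε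
  rw [e2, Finset.mul_sum]
  refine norm_sum_le_of_le _ fun i hi => ?_
  have hi' := Finset.mem_range.1 hi
  have h1 := D.mem_Icc hi'.le
  have h2 := D.mem_Icc (Nat.succ_le_of_lt hi')
  have hlt := D.lt i hi'
  have h0 := sub_nonneg.2 (hφ.le h1.1 hlt.le (h2.2.trans ht.2))
  refine (h _ _ h1.1 hlt.le (h2.2.trans ht.2)).trans ?_
  have h3 : φ (D.u (i + 1)) - φ (D.u i) ≤ η := by
    have := hδ' _ ⟨h2.1, h2.2.trans ht.2⟩ _ ⟨h1.1, h1.2.trans ht.2⟩ (by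
      rw [Real.dist_eq, abs_of_nonneg (by linarith)]; exact hD i hi')
    rw [Real.dist_eq, abs_of_nonneg h0] at this
    exact this.le
  have h4 : (φ (D.u (i + 1)) - φ (D.u i)) ^ θ =
      (φ (D.u (i + 1)) - φ (D.u i)) ^ (θ - 1) * (φ (D.u (i + 1)) - φ (D.u i)) := by
    conv_rhs => rw [← Real.rpow_add_one' h0 (by linarith), sub_add_cancel]
  rw [h4, ← mul_assoc]
  exact mul_le_mul_of_nonneg_right (mul_le_mul_of_nonneg_left
    (Real.rpow_le_rpow h0 h3 (by linarith)) hC) h0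

end Clock

/-! ### Change of time from a clock to Hölder paths -/

noncomputable section ClockEquation

variable {B : Type*} [NormedAddCommGroup B] [NormedSpace ℝ B] {φ : ℝ → ℝ} {a b : ℝ}

/-- Composition with `ψ` turns a `ClockBound` on `[a, b]` into a Hölder bound on `[φ a, φ b]`, and
composition with `φ` brings the results back. -/
theorem IsClock.exists_inverse (hφ : IsClock φ a b) (hab : a ≤ b) :
    ∃ ψ : ℝ → ℝ, (∀ t ∈ Icc a b, ψ (φ t) = t) ∧
      ∀ u v, φ a ≤ u → u ≤ v → v ≤ φ b → a ≤ ψ u ∧ ψ u ≤ ψ v ∧ ψ v ≤ b ∧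
        φ (ψ u) = u ∧ φ (ψ v) = v := by
  have h : ∀ s, ∃ t, s ∈ Icc (φ a) (φ b) → t ∈ Icc a b ∧ φ t = s := fun s => by
    by_cases hs : s ∈ Icc (φ a) (φ b)
    · obtain ⟨t, ht, hts⟩ := intermediate_value_Icc hab hφ.continuousOn hs
      exact ⟨t, fun _ => ⟨ht, hts⟩⟩
    · exact ⟨0, fun h => absurd h hs⟩
  choose ψ hψ using h
  refine ⟨ψ, fun t ht => ?_, fun u v h1 h2 h3 => ?_⟩
  · have := hψ (φ t) ⟨hφ.le le_rfl ht.1 ht.2, hφ.le ht.1 ht.2 le_rfl⟩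
    exact hφ.strictMonoOn.injOn this.1 ht this.2
  · obtain ⟨hu, hu'⟩ := hψ u ⟨h1, h2.trans h3⟩
    obtain ⟨hv, hv'⟩ := hψ v ⟨h1.trans h2, h3⟩
    exact ⟨hu.1, (hφ.strictMonoOn.le_iff_le hu hv).1 (by rw [hu', hv']; exact h2), hv.2, hu', hv'⟩

/-- The equation `dY = dX Y` in terms of the increments of the clock `φ`. -/
theorem IsClock.exists_solution [CompleteSpace B] (hφ : IsClock φ a b) {X : ℝ → B →L[ℝ] B}
    {H α : ℝ} (hα : 1 / 2 < α) (hH : 0 ≤ H) (hX : ClockBound φ H α X a b) (hab : a ≤ b) (y₀ : B) :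
    ∃ Y, Y a = y₀ ∧ ∃ C, 0 ≤ C ∧ ClockBound φ C α Y a b ∧ ∀ u v, a ≤ u → u ≤ v → v ≤ b →
      ‖Y v - Y u - (X v - X u) (Y u)‖ ≤ C * (φ v - φ u) ^ (2 * α) := by
  obtain ⟨ψ, h1, h2⟩ := hφ.exists_inverse hab
  have hX' : HolderOnIcc H α (fun s => X (ψ s)) (φ a) (φ b) := fun u v hu huv hv => by
    obtain ⟨h3, h4, h5, h6, h7⟩ := h2 u v hu huv hv
    have := hX _ _ h3 h4 h5
    rwa [h6, h7] at this
  obtain ⟨Y, hY0, C, hC, hY1, hY2⟩ :=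
    exists_isHolderSolution hα hH hX' (hφ.le le_rfl hab le_rfl) y₀
  refine ⟨fun t => Y (φ t), hY0, C, hC, fun u v hu huv hv => ?_, fun u v hu huv hv => ?_⟩
  · exact hY1 _ _ (hφ.le le_rfl hu (huv.trans hv)) (hφ.le hu huv hv) (hφ.le (hu.trans huv) hv le_rfl)
  · have := hY2 _ _ (hφ.le le_rfl hu (huv.trans hv)) (hφ.le hu huv hv)
      (hφ.le (hu.trans huv) hv le_rfl)
    simp only [h1 u ⟨hu, huv.trans hv⟩, h1 v ⟨hu.trans huv, hv⟩] at this
    exact this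

theorem IsClock.exists_backward_solution [CompleteSpace B] (hφ : IsClock φ a b)
    {X : ℝ → B →L[ℝ] B} {H α : ℝ} (hα : 1 / 2 < α) (hH : 0 ≤ H) (hX : ClockBound φ H α X a b)
    (hab : a ≤ b) (y₀ : B) :
    ∃ Y, Y b = y₀ ∧ ∃ C, 0 ≤ C ∧ ClockBound φ C α Y a b ∧ ∀ u v, a ≤ u → u ≤ v → v ≤ b →
      ‖Y v - Y u + (X v - X u) (Y v)‖ ≤ C * (φ v - φ u) ^ (2 * α) := by
  obtain ⟨ψ, h1, h2⟩ := hφ.exists_inverse hab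
  have hX' : HolderOnIcc H α (fun s => X (ψ s)) (φ a) (φ b) := fun u v hu huv hv => by
    obtain ⟨h3, h4, h5, h6, h7⟩ := h2 u v hu huv hv
    have := hX _ _ h3 h4 h5
    rwa [h6, h7] at this
  obtain ⟨Y, hY0, C, hC, hY1, hY2⟩ :=
    exists_backward_isHolderSolution hα hH hX' (hφ.le le_rfl hab le_rfl) y₀
  refine ⟨fun t => Y (φ t), hY0, C, hC, fun u v hu huv hv => ?_, fun u v hu huv hv => ?_⟩
  · exact hY1 _ _ (hφ.le le_rfl hu (huv.trans hv)) (hφ.le hu huv hv) (hφ.le (hu.trans huv) hv le_rfl)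
  · have := hY2 _ _ (hφ.le le_rfl hu (huv.trans hv)) (hφ.le hu huv hv)
      (hφ.le (hu.trans huv) hv le_rfl)
    simp only [h1 u ⟨hu, huv.trans hv⟩, h1 v ⟨hu.trans huv, hv⟩] at this
    exact this

/-- Young integration: existence of the indefinite integral `∫ m(y) dx`, with a local estimate. -/
theorem IsClock.exists_young {U F W : Type*} [NormedAddCommGroup U] [NormedSpace ℝ U]
    [NormedAddCommGroup F] [NormedSpace ℝ F] [NormedAddCommGroup W] [NormedSpace ℝ W]
    [CompleteSpace W] (hφ : IsClock φ a b) (m : U →L[ℝ] F →L[ℝ] W) {y : ℝ → U} {x : ℝ → F}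
    {c H α β : ℝ} (hα : 0 ≤ α) (hβ : 0 ≤ β) (hαβ : 1 < α + β) (hc : 0 ≤ c) (hH : 0 ≤ H)
    (hy : ClockBound φ c α y a b) (hx : ClockBound φ H β x a b) (hab : a ≤ b) :
    ∃ I : ℝ → W, ∃ C, 0 ≤ C ∧ ∀ u v, a ≤ u → u ≤ v → v ≤ b →
      ‖I v - I u - m (y u) (x v - x u)‖ ≤ C * (φ v - φ u) ^ (α + β) := by
  obtain ⟨ψ, h1, h2⟩ := hφ.exists_inverse hab
  have hy' : HolderOnIcc c α (fun s => y (ψ s)) (φ a) (φ b) := fun u v hu huv hv => by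
    obtain ⟨h3, h4, h5, h6, h7⟩ := h2 u v hu huv hv
    have := hy _ _ h3 h4 h5
    rwa [h6, h7] at this
  have hx' : HolderOnIcc H β (fun s => x (ψ s)) (φ a) (φ b) := fun u v hu huv hv => by
    obtain ⟨h3, h4, h5, h6, h7⟩ := h2 u v hu huv hv
    have := hx _ _ h3 h4 h5
    rwa [h6, h7] at this
  have hA := almostAdditive_of_holder m hα hβ (by linarith) hc hH hy' hx'
  have hK : 0 ≤ ‖m‖ * c * H := by positivity
  refine ⟨fun t => sew (fun u v => m (y (ψ u)) (x (ψ v) - x (ψ u))) (φ a) (φ b) (φ t),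
    sewConst (α + β) * (‖m‖ * c * H),
    mul_nonneg (sewConst_pos hαβ).le hK, fun u v hu huv hv => ?_⟩
  have := hA.norm_sew_sub_le hK hαβ (hφ.le le_rfl hu (huv.trans hv)) (hφ.le hu huv hv)
    (hφ.le (hu.trans huv) hv le_rfl)
  simp only [h1 u ⟨hu, huv.trans hv⟩, h1 v ⟨hu.trans huv, hv⟩] at this
  exact this

theorem ClockBound.mono {W : Type*} [SeminormedAddCommGroup W] {φ' : ℝ → ℝ} {H α : ℝ}
    {x : ℝ → W} (h : ClockBound φ H α x a b) (hH : 0 ≤ H) (hα : 0 ≤ α) (hφ : IsClock φ a b)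
    (hφ' : ∀ u v, a ≤ u → u ≤ v → v ≤ b → φ v - φ u ≤ φ' v - φ' u) : ClockBound φ' H α x a b :=
  fun u v h1 h2 h3 => (h u v h1 h2 h3).trans (mul_le_mul_of_nonneg_left
    (Real.rpow_le_rpow (sub_nonneg.2 (hφ.le h1 h2 h3)) (hφ' u v h1 h2 h3) hα) hH)

theorem ClockBound.map {W W' : Type*} [SeminormedAddCommGroup W] [NormedSpace ℝ W]
    [SeminormedAddCommGroup W'] [NormedSpace ℝ W'] (T : W →L[ℝ] W') {H α : ℝ}
    {x : ℝ → W} (h : ClockBound φ H α x a b) : ClockBound φ (‖T‖ * H) α (fun t => T (x t)) a b :=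
  fun u v h1 h2 h3 => by
    rw [← map_sub, mul_assoc]
    exact (T.le_opNorm _).trans (mul_le_mul_of_nonneg_left (h u v h1 h2 h3) (norm_nonneg _))

end ClockEquation

/-! ### The space `ℓ¹` and its universal property -/

noncomputable section EllOne

variable {ι : Type*} {B : Type*} [NormedAddCommGroup B] [NormedSpace ℝ B]

/-- The space `ℓ¹(ι)`. -/
abbrev EllOne (ι : Type*) := lp (fun _ : ι => ℝ) 1

namespace EllOne

theorem summable_norm (z : EllOne ι) : Summable fun i => ‖z i‖ := by
  simpa using (lp.memℓp z).summable (by simp)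

theorem norm_eq (z : EllOne ι) : ‖z‖ = ∑' i, ‖z i‖ := by
  simp [lp.norm_eq_tsum_rpow (p := 1) (by simp) z]

theorem summable_smul [CompleteSpace B] {f : ι → B} {M : ℝ} (hf : ∀ i, ‖f i‖ ≤ M)
    (z : EllOne ι) : Summable fun i => z i • f i :=
  Summable.of_norm_bounded ((summable_norm z).mul_right M) fun i => by
    rw [norm_smul]; exact mul_le_mul_of_nonneg_left (hf i) (norm_nonneg _)

/-- The linear extension of a bounded family. -/
def lift [CompleteSpace B] (f : ι → B) (M : ℝ) (hf : ∀ i, ‖f i‖ ≤ M) : EllOne ι →L[ℝ] B :=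
  LinearMap.mkContinuous
    { toFun := fun z => ∑' i, z i • f i
      map_add' := fun y z => by
        rw [← (summable_smul hf y).tsum_add (summable_smul hf z)]
        simp only [lp.coeFn_add, Pi.add_apply, add_smul]
      map_smul' := fun r z => by
        rw [RingHom.id_apply, ← (summable_smul hf z).tsum_const_smul]
        simp only [lp.coeFn_smul, Pi.smul_apply, smul_assoc] } M fun z => by
    refine tsum_of_norm_bounded (g := fun i => M * ‖z i‖) ?_ fun i => ?_
    · rw [norm_eq]; exact (summable_norm z).hasSum.mul_left M
    · rw [norm_smul, mul_comm]; exact mul_le_mul_of_nonneg_right (hf i) (norm_nonneg _)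

/-- The coordinate functionals. -/
def coord (i : ι) : EllOne ι →L[ℝ] ℝ := lp.evalCLM ℝ (fun _ : ι => ℝ) 1 i

theorem coord_apply (i : ι) (z : EllOne ι) : coord i z = z i := rfl

variable [DecidableEq ι]

/-- The standard unit vectors. -/
def unit (i : ι) : EllOne ι := lp.single 1 i 1

theorem unit_apply (i k : ι) : unit i k = if k = i then 1 else 0 := by
  rw [unit, lp.single_apply, Pi.single_apply]

theorem norm_unit (i : ι) : ‖unit i‖ = 1 := by
  rw [unit, lp.norm_single (by simp), norm_one]

theorem lift_unit [CompleteSpace B] (f : ι → B) (M : ℝ) (hf : ∀ i, ‖f i‖ ≤ M) (i : ι) :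
    lift f M hf (unit i) = f i := by
  show ∑' k, unit i k • f k = f i
  rw [tsum_eq_single i fun k hk => by rw [unit_apply, if_neg hk, zero_smul], unit_apply,
    if_pos rfl, one_smul]

theorem hom_ext {W : Type*} [AddCommMonoid W] [Module ℝ W] [TopologicalSpace W] [T2Space W]
    {S T : EllOne ι →L[ℝ] W} (h : ∀ i, S (unit i) = T (unit i)) : S = T :=
  lp.ext_continuousLinearMap (by simp) fun i => by
    ext
    exact h i

end EllOne

end EllOne

/-! ### Topology and levels of `T((V))` -/

noncomputable section TensorLevels

namespace TensorSeries

variable {V : Type*} [NormedAddCommGroup V] [NormedSpace ℝ V]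

/-- The coordinates in the product basis come from products of continuous functionals on `V`, so
they are continuous for the projective seminorm, and they separate points. -/
instance tensorPower_t2Space [FiniteDimensional ℝ V] (k : ℕ) : T2Space (⨂[ℝ]^k V) := by
  refine ⟨fun x y hxy => ?_⟩
  let e := Module.finBasis ℝ V
  let E := Basis.piTensorProduct fun _ : Fin k => e
  obtain ⟨q, hq⟩ : ∃ q, E.repr x q ≠ E.repr y q := by
    by_contra! h
    exact hxy (E.repr.injective (Finsupp.ext h))
  let g : ContinuousMultilinearMap ℝ (fun _ : Fin k => V) ℝ :=
    (ContinuousMultilinearMap.mkPiAlgebra ℝ (Fin k) ℝ).compContinuousLinearMap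
      fun i => (e.coord (q i)).toContinuousLinearMap
  have hg : PiTensorProduct.lift g.toMultilinearMap = E.coord q := by
    refine PiTensorProduct.ext (MultilinearMap.ext fun v => ?_)
    simp [g, E, Basis.piTensorProduct_repr_tprod_apply]
  have hc : Continuous (E.coord q) :=
    hg ▸ (PiTensorProduct.liftEquiv ℝ (fun _ : Fin k => V) ℝ g).continuous
  exact separated_by_continuous hc hq

instance instT2Space [FiniteDimensional ℝ V] : T2Space (TensorSeries V) :=
  inferInstanceAs (T2Space (∀ k : ℕ, ⨂[ℝ]^k V))

theorem continuous_level (n : ℕ) : Continuous fun z : TensorSeries V => z n :=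
  continuous_apply (A := fun n : ℕ => ⨂[ℝ]^n V) n

/-- The concatenation product as a bilinear map. -/
def levelMulₗ (i j : ℕ) : (⨂[ℝ]^i V) →ₗ[ℝ] (⨂[ℝ]^j V) →ₗ[ℝ] ⨂[ℝ]^(i + j) V :=
  (TensorProduct.mk ℝ _ _).compr₂ (TensorPower.mulEquiv : _ ≃ₗ[ℝ] ⨂[ℝ]^(i + j) V).toLinearMap

theorem continuous_mul_left [FiniteDimensional ℝ V] (A : TensorSeries V) :
    Continuous fun z => A * z := by
  refine continuous_pi (A := fun n : ℕ => ⨂[ℝ]^n V) fun n => ?_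
  simp only [mul_apply]
  refine continuous_finsetSum _ fun l _ => ?_
  exact (((TensorPower.cast ℝ V _).toLinearMap.comp
    (levelMulₗ (l : ℕ) (n - l) (A l))).continuous_of_finiteDimensional).comp (continuous_level _)

theorem continuous_mul_right [FiniteDimensional ℝ V] (A : TensorSeries V) :
    Continuous fun z => z * A := by
  refine continuous_pi (A := fun n : ℕ => ⨂[ℝ]^n V) fun n => ?_
  simp only [mul_apply]
  refine continuous_finsetSum _ fun l _ => ?_
  exact (((TensorPower.cast ℝ V _).toLinearMap.comp
    ((levelMulₗ (l : ℕ) (n - l)).flip (A (n - l)))).continuous_of_finiteDimensional).comp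
      (continuous_level _)

/-- Left multiplication as a continuous linear map. -/
def mulLeftL [FiniteDimensional ℝ V] (A : TensorSeries V) : TensorSeries V →L[ℝ] TensorSeries V :=
  ⟨LinearMap.mulLeft ℝ A, continuous_mul_left A⟩

/-- Right multiplication as a continuous linear map. -/
def mulRightL [FiniteDimensional ℝ V] (A : TensorSeries V) : TensorSeries V →L[ℝ] TensorSeries V :=
  ⟨LinearMap.mulRight ℝ A, continuous_mul_right A⟩

/-- The projection to a level. -/
def levelL (n : ℕ) : TensorSeries V →L[ℝ] ⨂[ℝ]^n V :=
  ⟨⟨⟨fun z => z n, fun _ _ => rfl⟩, fun _ _ => rfl⟩, continuous_level n⟩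

theorem update_fin_one {α : Type*} (f : Fin 1 → α) (w : α) :
    Function.update f 0 w = fun _ => w :=
  funext fun i => by rw [Subsingleton.elim i 0, Function.update_self]

/-- The inclusion of `V` is linear. -/
def ofVecₗ : V →ₗ[ℝ] TensorSeries V where
  toFun := ofVec
  map_add' u v := by
    have h := (tprod ℝ : MultilinearMap ℝ (fun _ : Fin 1 => V) _).map_update_add (fun _ => u) 0 u v
    simp only [update_fin_one] at h
    rw [ofVec, h]
    exact Pi.single_add _ _ _
  map_smul' r v := by
    have h := (tprod ℝ : MultilinearMap ℝ (fun _ : Fin 1 => V) _).map_update_smul (fun _ => v) 0 r v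
    simp only [update_fin_one] at h
    rw [ofVec, h]
    exact Pi.single_smul _ _ _

theorem ofVec_apply_ne {v : V} {k : ℕ} (h : k ≠ 1) : ofVec v k = 0 :=
  Pi.single_eq_of_ne h _

theorem levelMul_zero_left {i j : ℕ} (w : ⨂[ℝ]^j V) : levelMul (0 : ⨂[ℝ]^i V) w = 0 := by
  rw [levelMul_eq]; simp

theorem levelMul_zero_right {i j : ℕ} (w : ⨂[ℝ]^i V) : levelMul w (0 : ⨂[ℝ]^j V) = 0 := by
  rw [levelMul_eq]; simp

theorem ofVec_mul_zero (v : V) (y : TensorSeries V) : (ofVec v * y) 0 = 0 := by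
  rw [mul_apply]
  refine Finset.sum_eq_zero fun l _ => ?_
  rw [ofVec_apply_ne (by omega), levelMul_zero_left, map_zero]

theorem mul_ofVec_zero (v : V) (y : TensorSeries V) : (y * ofVec v) 0 = 0 := by
  rw [mul_apply]
  refine Finset.sum_eq_zero fun l _ => ?_
  rw [ofVec_apply_ne (by omega), levelMul_zero_right, map_zero]

theorem ofVec_mul_succ_congr (v : V) {y y' : TensorSeries V} {n : ℕ} (h : y n = y' n) :
    (ofVec v * y) (n + 1) = (ofVec v * y') (n + 1) := by
  rw [mul_apply, mul_apply]
  refine Finset.sum_congr rfl fun l _ => ?_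
  by_cases hl : (l : ℕ) = 1
  · have h1 : n + 1 - (l : ℕ) = n := by omega
    have h2 : y (n + 1 - (l : ℕ)) = y' (n + 1 - (l : ℕ)) := by rw [h1, h]
    rw [h2]
  · rw [ofVec_apply_ne hl, levelMul_zero_left, levelMul_zero_left]

theorem mul_ofVec_succ (v : V) (y : TensorSeries V) (n : ℕ) :
    (y * ofVec v) (n + 1) = levelMul (y n) (tprod ℝ fun _ : Fin 1 => v) := by
  rw [mul_apply, Finset.sum_eq_single (⟨n, by omega⟩ : Fin (n + 1 + 1))]
  · have key : ∀ (m : ℕ) (_ : m = 1) (h' : n + m = n + 1),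
        TensorPower.cast ℝ V h' (levelMul (y n) (ofVec v m)) =
          levelMul (y n) (tprod ℝ fun _ : Fin 1 => v) := by
      intro m hm h'
      subst hm
      simp [ofVec, incl, TensorPower.cast_refl]
    exact key _ (by simp) _
  · intro l _ hl
    have hl' : n + 1 - (l : ℕ) ≠ 1 := fun h => hl (Fin.ext (by simp; omega))
    rw [ofVec_apply_ne hl', levelMul_zero_right, map_zero]
  · simp

theorem one_apply_zero : (1 : TensorSeries V) 0 = tprod ℝ (Fin.elim0 : Fin 0 → V) :=
  Pi.single_eq_same (M := fun n : ℕ => ⨂[ℝ]^n V) 0 _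

theorem one_apply_ne {k : ℕ} (h : k ≠ 0) : (1 : TensorSeries V) k = 0 :=
  Pi.single_eq_of_ne h _

end TensorSeries

end TensorLevels

/-! ### Summable series of words and their evaluations -/

noncomputable section Words

variable {V : Type*} [NormedAddCommGroup V] [NormedSpace ℝ V]
variable {d : ℕ}

namespace WordSpace

open EllOne TensorSeries

/-- The space of summable families of coefficients of words in `d` letters. -/
abbrev _root_.WordSpace (d : ℕ) := EllOne (List (Fin d))

/-- Right multiplication by a letter. -/
def appendLetter (i : Fin d) : WordSpace d →L[ℝ] WordSpace d :=
  lift (fun w => unit (w ++ [i])) 1 fun _ => (norm_unit _).le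

/-- Left multiplication by a letter. -/
def consLetter (i : Fin d) : WordSpace d →L[ℝ] WordSpace d :=
  lift (fun w => unit (i :: w)) 1 fun _ => (norm_unit _).le

/-- Removal of a first letter `i`. -/
def stripLetter (i : Fin d) : WordSpace d →L[ℝ] WordSpace d :=
  lift (fun w => if w.head? = some i then unit w.tail else 0) 1 fun w => by
    split_ifs
    · exact (norm_unit _).le
    · simp

/-- A word is empty or has exactly one first letter. This is the recursion behind `map_eval`. -/
theorem eq_add_sum_cons_strip (z : WordSpace d) :
    z = coord [] z • unit [] + ∑ i, consLetter i (stripLetter i z) := by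
  have : ContinuousLinearMap.id ℝ (WordSpace d) = (coord []).smulRight (unit []) +
      ∑ i, (consLetter i).comp (stripLetter i) := by
    refine hom_ext fun w => ?_
    rw [_root_.add_apply, _root_.sum_apply, ContinuousLinearMap.smulRight_apply, coord_apply,
      unit_apply]
    simp only [ContinuousLinearMap.comp_apply, stripLetter, lift_unit,
      ContinuousLinearMap.id_apply]
    rcases w with _ | ⟨k, w⟩
    · simp
    · rw [Finset.sum_eq_single k]
      · simp [consLetter, lift_unit]
      · intro i _ hik
        simp [Ne.symm hik]
      · simp
  have h := congrArg (fun T => T z) this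
  simpa only [ContinuousLinearMap.id_apply, _root_.add_apply, _root_.sum_apply,
    ContinuousLinearMap.smulRight_apply, ContinuousLinearMap.comp_apply] using h

variable (e : Module.Basis (Fin d) ℝ V)

/-- Right multiplication by a vector, expanded in the basis `e`. -/
def mulVec : V →ₗ[ℝ] WordSpace d →L[ℝ] WordSpace d := e.constr ℝ appendLetter

theorem mulVec_basis (i : Fin d) : mulVec e (e i) = appendLetter i := e.constr_basis ℝ _ i

/-- The tensor `e_{i₁} ⊗ ⋯ ⊗ e_{i_k}` of a word `i₁ ⋯ i_k`. -/
def wordTensor (w : List (Fin d)) : TensorSeries V := (w.map fun i => ofVec (e i)).prod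

theorem wordTensor_nil : wordTensor e [] = 1 := rfl

theorem wordTensor_cons (i : Fin d) (w : List (Fin d)) :
    wordTensor e (i :: w) = ofVec (e i) * wordTensor e w := by
  simp [wordTensor]

theorem wordTensor_append (i : Fin d) (w : List (Fin d)) :
    wordTensor e (w ++ [i]) = wordTensor e w * ofVec (e i) := by
  simp [wordTensor]

theorem wordTensor_apply_ne (w : List (Fin d)) : ∀ k, w.length ≠ k → wordTensor e w k = 0 := by
  induction w with
  | nil => exact fun k hk => one_apply_ne (Ne.symm hk)
  | cons i w ih =>
    intro k hk
    rw [wordTensor_cons]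
    rcases k with _ | k
    · exact ofVec_mul_zero _ _
    · rw [ofVec_mul_succ_congr (e i) (y' := 0) (ih k fun h => hk (by simp [h])), mul_zero]
      rfl

/-- The tensor series with given coefficients of the words in the basis `e`. -/
def toSeries : WordSpace d →L[ℝ] TensorSeries V where
  toFun z k := ∑ w ∈ (List.finite_length_eq (Fin d) k).toFinset, coord w z • wordTensor e w k
  map_add' y z := by
    ext k
    show _ = (∑ w ∈ (List.finite_length_eq (Fin d) k).toFinset, coord w y • wordTensor e w k) +
      ∑ w ∈ (List.finite_length_eq (Fin d) k).toFinset, coord w z • wordTensor e w k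
    simp only [map_add, add_smul, Finset.sum_add_distrib]
  map_smul' r z := by
    ext k
    show _ = r • ∑ w ∈ (List.finite_length_eq (Fin d) k).toFinset, coord w z • wordTensor e w k
    simp only [map_smul, smul_assoc, Finset.smul_sum]
  cont := continuous_pi (A := fun n : ℕ => ⨂[ℝ]^n V) fun k =>
    continuous_finsetSum _ fun w _ => (coord w).continuous.smul continuous_const

theorem toSeries_unit (w : List (Fin d)) : toSeries e (unit w) = wordTensor e w := by
  ext k
  show ∑ w' ∈ (List.finite_length_eq (Fin d) k).toFinset, coord w' (unit w) • wordTensor e w' k = _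
  simp only [coord_apply, unit_apply, ite_smul, one_smul, zero_smul]
  rw [Finset.sum_ite_eq']
  split_ifs with h
  · rfl
  · refine (wordTensor_apply_ne e w k fun hk => h ?_).symm
    simpa using hk

variable {E : Type*} [NormedRing E] [NormedAlgebra ℝ E] (j : V →ₗ[ℝ] E)

/-- Uniform boundedness over all words is what lets evaluation extend to `ℓ¹`. The bound is `‖1‖`
because the norm of the unit of `E` need not be `1`. -/
theorem norm_word_le (hj : ∀ i, ‖j (e i)‖ ≤ 1) (w : List (Fin d)) :
    ‖(w.map fun i => j (e i)).prod‖ ≤ ‖(1 : E)‖ := by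
  induction w with
  | nil => simp
  | cons i w ih =>
    rw [List.map_cons, List.prod_cons]
    calc _ ≤ ‖j (e i)‖ * ‖(w.map fun i => j (e i)).prod‖ := norm_mul_le _ _
      _ ≤ 1 * ‖(1 : E)‖ := mul_le_mul (hj i) ih (norm_nonneg _) zero_le_one
      _ = _ := one_mul _

section

variable [FiniteDimensional ℝ V]

theorem toSeries_cons (i : Fin d) (z : WordSpace d) :
    toSeries e (consLetter i z) = ofVec (e i) * toSeries e z := by
  have : (toSeries e).comp (consLetter i) = (mulLeftL (ofVec (e i))).comp (toSeries e) :=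
    hom_ext fun w => by
      show toSeries e (consLetter i (unit w)) = ofVec (e i) * toSeries e (unit w)
      rw [consLetter, lift_unit, toSeries_unit, toSeries_unit, wordTensor_cons]
  exact congrArg (fun T => T z) this

theorem toSeries_append (i : Fin d) (z : WordSpace d) :
    toSeries e (appendLetter i z) = toSeries e z * ofVec (e i) := by
  have : (toSeries e).comp (appendLetter i) = (mulRightL (ofVec (e i))).comp (toSeries e) :=
    hom_ext fun w => by
      show toSeries e (appendLetter i (unit w)) = toSeries e (unit w) * ofVec (e i)
      rw [appendLetter, lift_unit, toSeries_unit, toSeries_unit, wordTensor_append]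
  exact congrArg (fun T => T z) this

theorem toSeries_mulVec (v : V) (z : WordSpace d) :
    toSeries e (mulVec e v z) = toSeries e z * ofVec v := by
  have : (((toSeries e).toLinearMap.comp (ContinuousLinearMap.apply ℝ _ z).toLinearMap).comp
      (mulVec e)) = (LinearMap.mulLeft ℝ (toSeries e z)).comp ofVecₗ := e.ext fun i => by
    show toSeries e (mulVec e (e i) z) = toSeries e z * ofVec (e i)
    rw [mulVec_basis, toSeries_append]
  exact congrArg (fun T => T v) this

end

variable [CompleteSpace E]

/-- Evaluation of a series of words in a Banach algebra. -/
def eval (hj : ∀ i, ‖j (e i)‖ ≤ 1) : WordSpace d →L[ℝ] E :=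
  lift (fun w => (w.map fun i => j (e i)).prod) ‖(1 : E)‖ (norm_word_le e j hj)

variable (hj : ∀ i, ‖j (e i)‖ ≤ 1)

theorem eval_unit_nil : eval e j hj (unit []) = 1 := by simp [eval, lift_unit]

theorem eval_cons (i : Fin d) (z : WordSpace d) :
    eval e j hj (consLetter i z) = j (e i) * eval e j hj z := by
  have : (eval e j hj).comp (consLetter i) =
      (ContinuousLinearMap.mul ℝ E (j (e i))).comp (eval e j hj) := hom_ext fun w => by
    simp [consLetter, eval, lift_unit]
  exact congrArg (fun T => T z) this

theorem eval_append (i : Fin d) (z : WordSpace d) :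
    eval e j hj (appendLetter i z) = eval e j hj z * j (e i) := by
  have : (eval e j hj).comp (appendLetter i) =
      ((ContinuousLinearMap.mul ℝ E).flip (j (e i))).comp (eval e j hj) := hom_ext fun w => by
    simp [appendLetter, eval, lift_unit]
  exact congrArg (fun T => T z) this

theorem eval_mulVec (v : V) (z : WordSpace d) :
    eval e j hj (mulVec e v z) = eval e j hj z * j v := by
  have : (((eval e j hj).toLinearMap.comp (ContinuousLinearMap.apply ℝ _ z).toLinearMap).comp
      (mulVec e)) = (LinearMap.mulLeft ℝ (eval e j hj z)).comp j := e.ext fun i => by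
    show eval e j hj (mulVec e (e i) z) = eval e j hj z * j (e i)
    rw [mulVec_basis, eval_append]
  exact congrArg (fun T => T v) this

/-- An algebra homomorphism `E → T((V))` that fixes `V` maps the value of a series of words to the
series itself, whether or not it is continuous. -/
theorem map_eval [FiniteDimensional ℝ V] (ι : E →ₐ[ℝ] TensorSeries V) (hι : ∀ v, ι (j v) = ofVec v) (z : WordSpace d) :
    ι (eval e j hj z) = toSeries e z := by
  -- Both sides satisfy the same recursion, a finite sum in which `ι` meets only sums and products.
  -- Left multiplication by a letter raises the level by one, so level `n + 1` is determined by
  -- level `n` of the stripped series.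
  have expand : ∀ z : WordSpace d, ι (eval e j hj z) =
      coord [] z • 1 + ∑ i, ofVec (e i) * ι (eval e j hj (stripLetter i z)) := fun z => by
    conv_lhs => rw [eq_add_sum_cons_strip z]
    simp only [map_add, map_smul, map_sum, eval_unit_nil, eval_cons, map_mul, map_one, hι]
  have expand' : ∀ z : WordSpace d, toSeries e z =
      coord [] z • 1 + ∑ i, ofVec (e i) * toSeries e (stripLetter i z) := fun z => by
    conv_lhs => rw [eq_add_sum_cons_strip z]
    simp only [map_add, map_smul, map_sum, toSeries_cons, toSeries_unit, wordTensor_nil]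
  have sum_level : ∀ (n : ℕ) (f : Fin d → TensorSeries V), (∑ i, f i) n = ∑ i, f i n :=
    fun n f => map_sum (levelL n) f Finset.univ
  ext n
  induction n generalizing z with
  | zero =>
    rw [expand, expand', TensorSeries.add_apply, TensorSeries.add_apply, sum_level, sum_level]
    simp only [ofVec_mul_zero]
  | succ n ih =>
    rw [expand, expand', TensorSeries.add_apply, TensorSeries.add_apply, sum_level, sum_level]
    congr 1
    exact Finset.sum_congr rfl fun i _ => ofVec_mul_succ_congr _ (ih _)

end WordSpace

end Words

/-! ### Formal properties of the Young integral -/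

section Congr

variable {U V W : Type*} [AddCommGroup V] [AddCommMonoid W]

theorem riemannSum_congr {m : U → V → W} {y y' : ℝ → U} {x : ℝ → V} {s t : ℝ}
    (h : EqOn y y' (Icc s t)) (D : IntervalPartition s t) :
    riemannSum m y x D = riemannSum m y' x D :=
  Finset.sum_congr rfl fun _ hi => by rw [h (D.mem_Icc (Finset.mem_range.1 hi).le)]

theorem HasYoungIntegral.congr [TopologicalSpace W] {m : U → V → W} {y y' : ℝ → U} {x : ℝ → V}
    {s t : ℝ} {I : W} (hI : HasYoungIntegral m y x s t I) (h : EqOn y y' (Icc s t)) :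
    HasYoungIntegral m y' x s t I := by
  unfold HasYoungIntegral at *
  simpa only [riemannSum_congr h] using hI

theorem HasYoungIntegral.map [TopologicalSpace W] {U' W' F : Type*} [AddCommMonoid W']
    [TopologicalSpace W'] [FunLike F W W'] [AddMonoidHomClass F W W'] {m : U → V → W}
    {m' : U' → V → W'} {y : ℝ → U} {x : ℝ → V} {s t : ℝ} {I : W}
    (hI : HasYoungIntegral m y x s t I) (T : F) (hT : Continuous T) (g : U → U')
    (hg : ∀ u v, T (m u v) = m' (g u) v) :
    HasYoungIntegral m' (fun r => g (y r)) x s t (T I) := by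
  have h := (hT.tendsto I).comp hI
  refine h.congr fun D => ?_
  simp only [Function.comp_apply, riemannSum, map_sum, hg]

theorem HasYoungIntegral.unique [TopologicalSpace W] [T2Space W] {m : U → V → W} {y : ℝ → U}
    {x : ℝ → V} {s t : ℝ} (hst : s ≤ t) {I J : W} (hI : HasYoungIntegral m y x s t I)
    (hJ : HasYoungIntegral m y x s t J) : I = J :=
  have := meshFilter_neBot hst
  tendsto_nhds_unique hI hJ

theorem HasYoungIntegral.eq_zero_of_self [TopologicalSpace W] [T2Space W] {m : U → V → W}
    {y : ℝ → U} {x : ℝ → V} {s : ℝ} {I : W} (hI : HasYoungIntegral m y x s s I) : I = 0 := by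
  have := meshFilter_neBot (le_refl s)
  refine tendsto_nhds_unique hI (tendsto_const_nhds.congr fun D => (Finset.sum_eq_zero ?_).symm)
  intro i hi
  have hi' := Finset.mem_range.1 hi
  exact absurd (D.lt i hi') (not_lt.2 ((D.mem_Icc (Nat.succ_le_of_lt hi')).2.trans
    (D.mem_Icc hi'.le).1))

theorem MemCp.congr {W : Type*} [SeminormedAddCommGroup W] {p : ℝ} {x x' : ℝ → W} {a b : ℝ}
    (hx : MemCp p x a b) (h : EqOn x x' (Icc a b)) : MemCp p x' a b := by
  obtain ⟨hc, C, hC⟩ := hx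
  refine ⟨hc.congr fun t ht => (h ht).symm, C, fun D => ?_⟩
  refine le_of_eq_of_le (Finset.sum_congr rfl fun i hi => ?_) (hC D)
  have hi' := Finset.mem_range.1 hi
  rw [h (D.mem_Icc hi'.le), h (D.mem_Icc (Nat.succ_le_of_lt hi'))]

end Congr

/-! ### Uniqueness level by level -/

section Levelwise

open TensorSeries

variable {V : Type*} [NormedAddCommGroup V] [NormedSpace ℝ V] {x : ℝ → V} {a b : ℝ}
  {A : TensorSeries V} {Q Q' : ℝ → TensorSeries V}

theorem riemannSum_level (n : ℕ) {s t : ℝ} (D : IntervalPartition s t) :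
    riemannSum (fun (y : TensorSeries V) (v : V) => y * ofVec v) Q x D n =
      ∑ i ∈ Finset.range D.n, (Q (D.u i) * ofVec (x (D.u (i + 1)) - x (D.u i))) n := by
  show levelL n (riemannSum (fun (y : TensorSeries V) (v : V) => y * ofVec v) Q x D) = _
  rw [riemannSum, map_sum]
  rfl

theorem SolvesLevelwise.hasYoungIntegral_level (h : SolvesLevelwise x a b A Q) {t : ℝ}
    (ht : t ∈ Icc a b) (n : ℕ) :
    HasYoungIntegral (fun (w : ⨂[ℝ]^n V) (v : V) => levelMul w (tprod ℝ fun _ : Fin 1 => v))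
      (fun r => Q r n) x a t (Q t (n + 1) - A (n + 1)) := by
  refine (((continuous_level (n + 1)).tendsto _).comp (h t ht)).congr fun D => ?_
  rw [Function.comp_apply, riemannSum_level]
  simp only [mul_ofVec_succ, riemannSum]

variable [FiniteDimensional ℝ V]

theorem SolvesLevelwise.level_zero (h : SolvesLevelwise x a b A Q) {t : ℝ} (ht : t ∈ Icc a b) :
    Q t 0 = A 0 := by
  have := meshFilter_neBot ht.1
  have h0 := ((continuous_level 0).tendsto _).comp (h t ht)
  refine sub_eq_zero.1 (tendsto_nhds_unique h0 (tendsto_const_nhds.congr fun D => ?_))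
  rw [Function.comp_apply, riemannSum_level]
  simp only [mul_ofVec_zero, Finset.sum_const_zero]

/-- The system is triangular: level `0` is constant and level `n + 1` is the integral of level `n`.
Limits are unique, so no regularity of the solutions is needed. -/
theorem SolvesLevelwise.eqOn (h : SolvesLevelwise x a b A Q) (h' : SolvesLevelwise x a b A Q') :
    EqOn Q Q' (Icc a b) := by
  suffices ∀ n, ∀ t ∈ Icc a b, Q t n = Q' t n from fun t ht => TensorSeries.ext fun n => this n t ht
  intro n
  induction n with
  | zero => exact fun t ht => (h.level_zero ht).trans (h'.level_zero ht).symm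
  | succ n ih =>
    intro t ht
    have h1 := (h.hasYoungIntegral_level ht n).congr
      (fun r hr => ih r ⟨hr.1, hr.2.trans ht.2⟩ : EqOn (fun r => Q r n) (fun r => Q' r n) _)
    exact sub_left_injective (h1.unique ht.1 (h'.hasYoungIntegral_level ht n))

theorem SolvesLevelwise.eq_signature (h : SolvesLevelwise x a b 1 Q) {t : ℝ} (ht : t ∈ Icc a b) :
    Q t = signature x a t := by
  suffices ∀ n, ∀ t ∈ Icc a b, Q t n = iteratedIntegral x a n t from
    TensorSeries.ext fun n => this n t ht
  intro n
  induction n with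
  | zero => exact fun t ht => (h.level_zero ht).trans one_apply_zero
  | succ n ih =>
    intro t ht
    have h1 := (h.hasYoungIntegral_level ht n).congr
      (fun r hr => ih r ⟨hr.1, hr.2.trans ht.2⟩ :
        EqOn (fun r => Q r n) (fun r => iteratedIntegral x a n r) _)
    rw [one_apply_ne (Nat.succ_ne_zero n), sub_zero] at h1
    have := meshFilter_neBot ht.1
    exact (Tendsto.limUnder_eq h1).symm

end Levelwise

/-! ### The solution in the space of words and the signature -/

section WordSolution

open TensorSeries WordSpace EllOne

variable {V : Type*} [NormedAddCommGroup V] [NormedSpace ℝ V]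
  {d : ℕ} {e : Module.Basis (Fin d) ℝ V} {x : ℝ → V} {a b p C : ℝ} {φ : ℝ → ℝ}
  {Y : ℝ → WordSpace d}

/-- `Y` is the solution of `dY = Y dx` in the space of summable families of words, started at the
empty word, with estimates in terms of the clock `φ`. -/
structure IsWordSolution (e : Module.Basis (Fin d) ℝ V) (p : ℝ) (x : ℝ → V) (a b : ℝ) (φ : ℝ → ℝ)
    (C : ℝ) (Y : ℝ → WordSpace d) : Prop where
  clock : IsClock φ a b
  nonneg : 0 ≤ C
  driver : ClockBound φ 1 (1 / p) x a b
  init : Y a = unit []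
  bound : ClockBound φ C (1 / p) Y a b
  increment : ∀ u v, a ≤ u → u ≤ v → v ≤ b →
    ‖Y v - Y u - mulVec e (x v - x u) (Y u)‖ ≤ C * (φ v - φ u) ^ (2 * (1 / p))

theorem one_lt_two_mul_one_div (hp1 : 1 ≤ p) (hp2 : p < 2) : 1 < 2 * (1 / p) := by
  have hp : 0 < p := by linarith
  rw [mul_one_div, lt_div_iff₀ hp]
  linarith

theorem exists_isWordSolution [FiniteDimensional ℝ V]
    (e : Module.Basis (Fin d) ℝ V) (hp1 : 1 ≤ p) (hp2 : p < 2)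
    (hab : a ≤ b) (hx : MemCp p x a b) : ∃ φ C Y, IsWordSolution e p x a b φ C Y := by
  obtain ⟨φ, hφ, hxφ⟩ := hx.exists_clock (by linarith)
  have h1 := one_lt_two_mul_one_div hp1 hp2
  let M : V →L[ℝ] WordSpace d →L[ℝ] WordSpace d := (mulVec e).toContinuousLinearMap
  obtain ⟨Y, hY0, C, hC, hY1, hY2⟩ := hφ.exists_solution (by linarith)
    (by positivity) (hxφ.map M) hab (unit [])
  refine ⟨φ, C, Y, hφ, hC, hxφ, hY0, hY1, fun u v hu huv hv => ?_⟩
  have := hY2 u v hu huv hv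
  rw [← map_sub] at this
  exact this

theorem IsWordSolution.hasYoungIntegral (h : IsWordSolution e p x a b φ C Y) (hp1 : 1 ≤ p)
    (hp2 : p < 2) {t : ℝ} (ht : t ∈ Icc a b) :
    HasYoungIntegral (fun (z : WordSpace d) (v : V) => mulVec e v z) Y x a t (Y t - unit []) := by
  rw [← h.init]
  exact hasYoungIntegral_of_local h.clock (one_lt_two_mul_one_div hp1 hp2) h.nonneg h.increment ht

theorem IsWordSolution.solvesLevelwise [FiniteDimensional ℝ V]
    (h : IsWordSolution e p x a b φ C Y) (hp1 : 1 ≤ p)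
    (hp2 : p < 2) (A : TensorSeries V) :
    SolvesLevelwise x a b A (fun t => A * toSeries e (Y t)) := by
  intro t ht
  have h1 := (h.hasYoungIntegral hp1 hp2 ht).map
    (m' := fun (y : TensorSeries V) (v : V) => y * ofVec v)
    ((mulLeftL A).comp (toSeries e)) (ContinuousLinearMap.continuous _)
    (fun z => A * toSeries e z) fun z v => by
      show A * toSeries e (mulVec e v z) = _
      rw [toSeries_mulVec, mul_assoc]
  convert h1 using 1
  show _ = A * toSeries e (Y t - unit [])
  rw [map_sub, toSeries_unit, wordTensor_nil, mul_sub, mul_one]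

theorem IsWordSolution.toSeries_eq_signature [FiniteDimensional ℝ V]
    (h : IsWordSolution e p x a b φ C Y) (hp1 : 1 ≤ p)
    (hp2 : p < 2) {t : ℝ} (ht : t ∈ Icc a b) : toSeries e (Y t) = signature x a t := by
  have := (h.solvesLevelwise hp1 hp2 1).eq_signature ht
  rwa [one_mul] at this

theorem IsWordSolution.memCp_map (h : IsWordSolution e p x a b φ C Y) (hp1 : 1 ≤ p)
    {W : Type*} [SeminormedAddCommGroup W] [NormedSpace ℝ W] (T : WordSpace d →L[ℝ] W) :
    MemCp p (fun t => T (Y t)) a b :=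
  h.clock.memCp (by linarith) (mul_nonneg (norm_nonneg _) h.nonneg) (h.bound.map T)

/-- After `t` nothing moves, and clock increments only shrink under stopping; hence the same clock
and the same constant serve. -/
theorem IsWordSolution.stopped (h : IsWordSolution e p x a b φ C Y) (hp1 : 1 ≤ p) {t : ℝ}
    (ht : t ∈ Icc a b) :
    IsWordSolution e p (fun r => x (min r t)) a b φ C (fun r => Y (min r t)) := by
  have key : ∀ u v, a ≤ u → u ≤ v → v ≤ b → a ≤ min u t ∧ min u t ≤ min v t ∧ min v t ≤ b ∧
      0 ≤ φ (min v t) - φ (min u t) ∧ φ (min v t) - φ (min u t) ≤ φ v - φ u := by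
    intro u v hu huv hv
    have h1 : a ≤ min u t := le_min hu ht.1
    have h2 : min u t ≤ min v t := min_le_min huv le_rfl
    have h3 : min v t ≤ b := (min_le_left _ _).trans hv
    refine ⟨h1, h2, h3, sub_nonneg.2 (h.clock.le h1 h2 h3), ?_⟩
    rcases le_total u t with h4 | h4
    · rw [min_eq_left h4]
      linarith [h.clock.le (hu.trans (le_min huv h4)) (min_le_left v t) hv]
    · rw [min_eq_right h4, min_eq_right (h4.trans huv)]
      linarith [h.clock.le hu huv hv]
  have hp : 0 ≤ 1 / p := by positivity
  have hp' : 0 ≤ 2 * (1 / p) := by positivity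
  refine ⟨h.clock, h.nonneg, fun u v hu huv hv => ?_, ?_, fun u v hu huv hv => ?_,
    fun u v hu huv hv => ?_⟩
  · obtain ⟨h1, h2, h3, h4, h5⟩ := key u v hu huv hv
    exact (h.driver _ _ h1 h2 h3).trans
      (mul_le_mul_of_nonneg_left (Real.rpow_le_rpow h4 h5 hp) zero_le_one)
  · rw [min_eq_left ht.1, h.init]
  · obtain ⟨h1, h2, h3, h4, h5⟩ := key u v hu huv hv
    exact (h.bound _ _ h1 h2 h3).trans
      (mul_le_mul_of_nonneg_left (Real.rpow_le_rpow h4 h5 hp) h.nonneg)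
  · obtain ⟨h1, h2, h3, h4, h5⟩ := key u v hu huv hv
    exact (h.increment _ _ h1 h2 h3).trans
      (mul_le_mul_of_nonneg_left (Real.rpow_le_rpow h4 h5 hp') h.nonneg)

/-- The path stopped at `t` has, over `[a, b]`, the signature of `x` over `[a, t]`. -/
theorem signature_mem_signatureRange [FiniteDimensional ℝ V]
    (hp1 : 1 ≤ p) (hp2 : p < 2) (hab : a ≤ b)
    (hx : MemCp p x a b) {t : ℝ} (ht : t ∈ Icc a b) : signature x a t ∈ signatureRange V p a b := by
  obtain ⟨φ, C, Y, h⟩ := exists_isWordSolution (Module.finBasis ℝ V) hp1 hp2 hab hx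
  have hs := h.stopped hp1 ht
  refine ⟨fun r => x (min r t), hs.clock.memCp (by linarith) zero_le_one hs.driver, ?_⟩
  rw [← hs.toSeries_eq_signature hp1 hp2 ⟨hab, le_rfl⟩, ← h.toSeries_eq_signature hp1 hp2 ht,
    min_eq_right ht.2]

end WordSolution

/-! ### Uniqueness in the norm of `E` -/

section NormUniqueness

variable {V : Type*} [NormedAddCommGroup V] [NormedSpace ℝ V]
  {E : Type*} [NormedRing E] [NormedAlgebra ℝ E]

theorem ClockBound.exists_norm_le {W : Type*} [SeminormedAddCommGroup W] {φ : ℝ → ℝ} {a b H α : ℝ}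
    {x : ℝ → W} (hx : ClockBound φ H α x a b) (hφ : IsClock φ a b) (hH : 0 ≤ H) (hα : 0 ≤ α) :
    ∃ M, 0 ≤ M ∧ ∀ t ∈ Icc a b, ‖x t‖ ≤ M := by
  refine ⟨max 0 (‖x a‖ + H * (φ b - φ a) ^ α), le_max_left _ _, fun t ht => le_max_of_le_right ?_⟩
  have h1 := norm_sub_norm_le (x t) (x a)
  have h2 := hx a t le_rfl ht.1 ht.2
  have h3 := hφ.le le_rfl ht.1 ht.2
  have h4 := hφ.le ht.1 ht.2 le_rfl
  have h5 : H * (φ t - φ a) ^ α ≤ H * (φ b - φ a) ^ α :=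
    mul_le_mul_of_nonneg_left (Real.rpow_le_rpow (by linarith) (by linarith) hα) hH
  linarith

theorem rpow_le_mul_rpow {w L θ θ₀ : ℝ} (hw : 0 ≤ w) (hwL : w ≤ L) (h0 : 0 < θ₀) (h : θ₀ ≤ θ) :
    w ^ θ ≤ L ^ (θ - θ₀) * w ^ θ₀ := by
  have : w ^ θ = w ^ (θ - θ₀) * w ^ θ₀ := by
    rw [← Real.rpow_add' hw (by linarith), sub_add_cancel]
  rw [this]
  exact mul_le_mul_of_nonneg_right (Real.rpow_le_rpow hw hwL (by linarith))
    (Real.rpow_nonneg hw _)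

theorem SolvesInNorm.restrict {j : V →ₗ[ℝ] E} {p : ℝ} {x : ℝ → V} {a b t : ℝ} {A : E}
    {Z : ℝ → E} (hZ : SolvesInNorm j p x a b A Z) (ht : t ≤ b) : SolvesInNorm j p x a t A Z := by
  obtain ⟨q, hq1, hq, C, hC⟩ := hZ.finiteVariation
  refine ⟨hZ.continuousOn.mono (Icc_subset_Icc_right ht), ⟨q, hq1, hq, ?_⟩,
    fun s hs => hZ.integral_eq s ⟨hs.1, hs.2.trans ht⟩⟩
  obtain ⟨K, hK⟩ := HasFiniteVariation.bddAbove ⟨C, hC⟩ ht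
  exact ⟨K, fun D => hK ⟨D, rfl⟩⟩

variable [FiniteDimensional ℝ V] [CompleteSpace E]

/-- A solution of `dZ = Z dx` in norm satisfies a local estimate. -/
theorem SolvesInNorm.exists_increment {j : V →ₗ[ℝ] E} {p : ℝ} {x : ℝ → V} {a b : ℝ} {A : E}
    {Z : ℝ → E} (hZ : SolvesInNorm j p x a b A Z) (hp1 : 1 ≤ p) (hab : a ≤ b) {φ : ℝ → ℝ}
    (hφ : IsClock φ a b) (hx : ClockBound φ 1 (1 / p) x a b) :
    ∃ (ψ : ℝ → ℝ) (θ C M : ℝ), IsClock ψ a b ∧ (∀ u v, a ≤ u → u ≤ v → v ≤ b → φ v - φ u ≤ ψ v - ψ u) ∧ 1 < θ ∧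
      0 ≤ C ∧ 0 ≤ M ∧ (∀ t ∈ Icc a b, ‖Z t‖ ≤ M) ∧ ∀ u v, a ≤ u → u ≤ v → v ≤ b →
        ‖Z v - Z u - Z u * j (x v - x u)‖ ≤ C * (ψ v - ψ u) ^ θ := by
  obtain ⟨q, hq1, hq, hvar⟩ := hZ.finiteVariation
  obtain ⟨χ, hχ, hZχ⟩ := MemCp.exists_clock (by linarith) ⟨hZ.continuousOn, hvar⟩
  have hφψ : ∀ u v, a ≤ u → u ≤ v → v ≤ b → φ v - φ u ≤ (φ v + χ v) - (φ u + χ u) :=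
    fun u v h1 h2 h3 => by linarith [hχ.le h1 h2 h3]
  have hχψ : ∀ u v, a ≤ u → u ≤ v → v ≤ b → χ v - χ u ≤ (φ v + χ v) - (φ u + χ u) :=
    fun u v h1 h2 h3 => by linarith [hφ.le h1 h2 h3]
  -- The sum of the clocks of `x` and `Z` controls both paths, with exponents `1 / p` and `1 / q`,
  -- whose sum exceeds one.
  have hψ := hφ.add hχ
  have hp0 : 0 ≤ 1 / p := by positivity
  have hq0 : 0 ≤ 1 / q := by positivity
  let m : E →L[ℝ] V →L[ℝ] E := (ContinuousLinearMap.mul ℝ E).bilinearComp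
    (ContinuousLinearMap.id ℝ E) j.toContinuousLinearMap
  obtain ⟨I, C, hC, hI⟩ := hψ.exists_young m hq0 hp0 (by linarith) zero_le_one zero_le_one
    (hZχ.mono zero_le_one hq0 hχ hχψ) (hx.mono zero_le_one hp0 hφ hφψ) hab
  -- The sewn integral and the integral in the equation are limits of the same Riemann sums, so `Z`
  -- inherits the local estimate of `I`.
  have hIZ : ∀ t ∈ Icc a b, I t - I a = Z t - A := fun t ht =>
    (hasYoungIntegral_of_local (m := fun (y : E) (v : V) => y * j v) hψ
      (show 1 < 1 / q + 1 / p by linarith) hC hI ht).unique ht.1 (hZ.integral_eq t ht)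
  obtain ⟨M, hM, hZM⟩ := hZχ.exists_norm_le hχ zero_le_one hq0
  refine ⟨_, 1 / q + 1 / p, C, M, hψ, hφψ, by linarith, hC, hM, hZM, fun u v h1 h2 h3 => ?_⟩
  have e : Z v - Z u = I v - I u := by
    have h4 := hIZ u ⟨h1, h2.trans h3⟩
    have h5 := hIZ v ⟨h1.trans h2, h3⟩
    have : Z v - Z u = (Z v - A) - (Z u - A) := by abel
    rw [this, ← h4, ← h5]
    abel
  rw [e]
  exact hI u v h1 h2 h3

/-- The value at `b` of a solution of `dZ = Z dx` in norm is determined by its value at `a`. -/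
theorem exists_solvesInNorm_eq_mul (j : V →ₗ[ℝ] E) {p : ℝ} (hp1 : 1 ≤ p) (hp2 : p < 2) {x : ℝ → V}
    {a b : ℝ} (hab : a ≤ b) (hx : MemCp p x a b) :
    ∃ r : E, ∀ A Z, SolvesInNorm j p x a b A Z → Z b = A * r := by
  obtain ⟨φ, hφ, hxφ⟩ := hx.exists_clock (by linarith)
  have h1 := one_lt_two_mul_one_div hp1 hp2
  let M : V →L[ℝ] E →L[ℝ] E := (ContinuousLinearMap.mul ℝ E).comp j.toContinuousLinearMap
  -- The dual equation `dR = -dx R` with `R b = 1`. It depends on `x` alone, so `R a` serves for all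
  -- `A` and `Z`.
  obtain ⟨R, hR1, D, hD, hRφ, hR⟩ := hφ.exists_backward_solution (by linarith)
    (by positivity) (hxφ.map M) hab 1
  obtain ⟨N, hN, hRN⟩ := hRφ.exists_norm_le hφ hD (by positivity)
  refine ⟨R a, fun A Z hZ => ?_⟩
  obtain ⟨ψ, θ, C, K, hψ, hφψ, hθ, hC, hK, hZK, hinc⟩ := hZ.exists_increment hp1 hab hφ hxφ
  set θ₀ := min θ (2 * (1 / p)) with hθ₀
  have hθ1 : 1 < θ₀ := lt_min hθ h1
  set L := ψ b - ψ a with hL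
  have hL0 : 0 ≤ L := sub_nonneg.2 (hψ.le le_rfl hab le_rfl)
  -- First-order terms cancel in the increment of `Z R`, because the equation for `Z` is expanded at
  -- the left endpoint and that for `R` at the right one. The zero integrand puts this in the form
  -- of `hasYoungIntegral_of_local`; the powers of `L` bring both errors to the common exponent
  -- `θ₀`.
  have hG : ∀ u v, a ≤ u → u ≤ v → v ≤ b →
      ‖Z v * R v - Z u * R u - (fun (_ : E) (_ : V) => (0 : E)) (Z u) (x v - x u)‖ ≤
        (C * L ^ (θ - θ₀) * N + K * D * L ^ (2 * (1 / p) - θ₀)) * (ψ v - ψ u) ^ θ₀ := by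
    intro u v hu huv hv
    have hw : 0 ≤ ψ v - ψ u := sub_nonneg.2 (hψ.le hu huv hv)
    have hwL : ψ v - ψ u ≤ L := by
      linarith [hψ.le le_rfl hu (huv.trans hv), hψ.le (hu.trans huv) hv le_rfl]
    have e1 : Z v * R v - Z u * R u - 0 = (Z v - Z u - Z u * j (x v - x u)) * R v
        + Z u * (R v - R u + j (x v - x u) * R v) := by
      noncomm_ring
    have h2 := hR u v hu huv hv
    rw [← map_sub] at h2
    have h2' : ‖R v - R u + j (x v - x u) * R v‖ ≤ D * (ψ v - ψ u) ^ (2 * (1 / p)) :=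
      h2.trans (mul_le_mul_of_nonneg_left (Real.rpow_le_rpow (sub_nonneg.2 (hφ.le hu huv hv))
        (hφψ u v hu huv hv) (by linarith)) hD)
    rw [e1]
    calc _ ≤ (C * (ψ v - ψ u) ^ θ) * N + K * (D * (ψ v - ψ u) ^ (2 * (1 / p))) :=
          (norm_add_le _ _).trans (add_le_add
            ((norm_mul_le _ _).trans (mul_le_mul (hinc u v hu huv hv)
              (hRN v ⟨hu.trans huv, hv⟩) (norm_nonneg _) (by positivity)))
            ((norm_mul_le _ _).trans (mul_le_mul (hZK u ⟨hu, huv.trans hv⟩) h2'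
              (norm_nonneg _) hK)))
      _ ≤ (C * (L ^ (θ - θ₀) * (ψ v - ψ u) ^ θ₀)) * N
          + K * (D * (L ^ (2 * (1 / p) - θ₀) * (ψ v - ψ u) ^ θ₀)) := by
        have h3 := rpow_le_mul_rpow hw hwL (by linarith) (min_le_left θ (2 * (1 / p)))
        have h4 := rpow_le_mul_rpow hw hwL (by linarith) (min_le_right θ (2 * (1 / p)))
        gcongr
      _ = _ := by ring
  have hzero := hasYoungIntegral_of_local (m := fun (_ : E) (_ : V) => (0 : E)) (y := Z) (x := x)
    (F := fun t => Z t * R t) hψ hθ1 (by positivity) hG (t := b) ⟨hab, le_rfl⟩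
  have hzero' : HasYoungIntegral (fun (_ : E) (_ : V) => (0 : E)) Z x a b 0 := by
    refine tendsto_const_nhds.congr fun D => ?_
    simp [riemannSum]
  have h5 := hzero.unique hab hzero'
  have hA : Z a = A := sub_eq_zero.1 (hZ.integral_eq a ⟨le_rfl, hab⟩).eq_zero_of_self
  rw [hR1, mul_one, hA] at h5
  exact sub_eq_zero.1 h5

theorem SolvesInNorm.eqOn {j : V →ₗ[ℝ] E} {p : ℝ} (hp1 : 1 ≤ p) (hp2 : p < 2) {x : ℝ → V}
    {a b : ℝ} (hx : MemCp p x a b) {A : E} {Z Z' : ℝ → E} (hZ : SolvesInNorm j p x a b A Z)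
    (hZ' : SolvesInNorm j p x a b A Z') : EqOn Z Z' (Icc a b) := by
  intro t ht
  have hxt : MemCp p x a t := by
    obtain ⟨K, hK⟩ := hx.2.bddAbove ht.2
    exact ⟨hx.1.mono (Icc_subset_Icc_right ht.2), K, fun D => hK ⟨D, rfl⟩⟩
  obtain ⟨r, hr⟩ := exists_solvesInNorm_eq_mul j hp1 hp2 ht.1 hxt
  rw [hr A Z (hZ.restrict ht.2), hr A Z' (hZ'.restrict ht.2)]

end NormUniqueness

/-! ### Existence in `E` and the main theorem -/

section Main

open TensorSeries WordSpace EllOne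

variable {V : Type*} [NormedAddCommGroup V] [NormedSpace ℝ V] [FiniteDimensional ℝ V]
  {E : Type*} [NormedRing E] [NormedAlgebra ℝ E]

/-- Any basis, divided by one plus the sum of the norms of its images. -/
theorem exists_basis_norm_map_le_one (j : V →ₗ[ℝ] E) :
    ∃ e : Module.Basis (Fin (Module.finrank ℝ V)) ℝ V, ∀ i, ‖j (e i)‖ ≤ 1 := by
  let e := Module.finBasis ℝ V
  set s := 1 + ∑ i, ‖j (e i)‖ with hs
  have hs0 : 0 < s := by positivity
  refine ⟨e.isUnitSMul (w := fun _ => s⁻¹) fun _ => (inv_ne_zero hs0.ne').isUnit, fun i => ?_⟩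
  rw [Module.Basis.isUnitSMul_apply, map_smul, norm_smul, norm_inv, Real.norm_of_nonneg hs0.le,
    inv_mul_le_iff₀ hs0, mul_one]
  have := Finset.single_le_sum (f := fun i => ‖j (e i)‖) (fun _ _ => norm_nonneg _)
    (Finset.mem_univ i)
  linarith

variable [CompleteSpace E]

/-- In a Banach algebra containing `V`, left multiples of the signature solve `dY = Y dx`. -/
theorem solvesInNorm_mul_signature {ι : E →ₐ[ℝ] TensorSeries V} (hι : Function.Injective ι) {p : ℝ}
    (hp1 : 1 ≤ p) (hp2 : p < 2) {a b : ℝ} (hab : a ≤ b) {x : ℝ → V} (hx : MemCp p x a b)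
    {S : ℝ → E} (hS : ∀ t ∈ Icc a b, ι (S t) = signature x a t) {j : V →ₗ[ℝ] E}
    (hj : ∀ v, ι (j v) = ofVec v) (A : E) :
    MemCp p (fun t => A * S t) a b ∧ SolvesInNorm j p x a b A (fun t => A * S t) := by
  obtain ⟨e, he⟩ := exists_basis_norm_map_le_one j
  obtain ⟨φ, C, Y, hY⟩ := exists_isWordSolution e hp1 hp2 hab hx
  have hSY : EqOn (fun t => A * eval e j he (Y t)) (fun t => A * S t) (Icc a b) := fun t ht => by
    -- `S` is known only through `ι`; this identity is what gives it regularity in the norm of `E`.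
    have : eval e j he (Y t) = S t := hι (by
      rw [map_eval e j he ι hj, hY.toSeries_eq_signature hp1 hp2 ht, hS t ht])
    simp only [this]
  let T : WordSpace _ →L[ℝ] E := (ContinuousLinearMap.mul ℝ E A).comp (eval e j he)
  have hmem : MemCp p (fun t => A * S t) a b := (hY.memCp_map hp1 T).congr hSY
  refine ⟨hmem, hmem.1, ⟨p, hp1, ?_, hmem.2⟩, fun t ht => ?_⟩
  · rw [← two_mul]; exact one_lt_two_mul_one_div hp1 hp2
  · have h1 := (hY.hasYoungIntegral hp1 hp2 ht).map (m' := fun (y : E) (v : V) => y * j v) T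
      T.continuous (fun z => A * eval e j he z) fun z v => by
        show A * eval e j he (mulVec e v z) = _
        rw [eval_mulVec, mul_assoc]
    have h2 : T (Y t - unit []) = A * S t - A := by
      show A * eval e j he (Y t - unit []) = _
      rw [map_sub, eval_unit_nil, mul_sub, mul_one]
      exact congrArg (· - A) (hSY ht)
    rw [h2] at h1
    exact h1.congr (hSY.mono (Icc_subset_Icc_right ht.2))

theorem isUniqueSolution_mul_signature {ι : E →ₐ[ℝ] TensorSeries V} (hι : Function.Injective ι)
    {p : ℝ} (hp1 : 1 ≤ p) (hp2 : p < 2) {a b : ℝ} (hab : a ≤ b) {x : ℝ → V} (hx : MemCp p x a b)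
    {S : ℝ → E} (hS : ∀ t ∈ Icc a b, ι (S t) = signature x a t) (A : E) :
    IsUniqueSolution ι p x a b A (fun t => A * S t) := by
  obtain ⟨φ, C, Y, hY⟩ := exists_isWordSolution (Module.finBasis ℝ V) hp1 hp2 hab hx
  have hSY : EqOn (fun t => ι A * toSeries (Module.finBasis ℝ V) (Y t))
      (fun t => ι (A * S t)) (Icc a b) := fun t ht => by
    simp only [map_mul, hS t ht, hY.toSeries_eq_signature hp1 hp2 ht]
  have hsol : SolvesLevelwise x a b (ι A) (fun t => ι (A * S t)) := fun t ht => by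
    have h1 := (hY.solvesLevelwise hp1 hp2 (ι A) t ht).congr
      (hSY.mono (Icc_subset_Icc_right ht.2))
    have h2 := hSY ht
    dsimp only at h1 h2
    rwa [h2] at h1
  refine ⟨hsol, fun k => ?_, fun Z hZ t ht => hι (hZ.eqOn hsol ht), fun j hj => ?_, fun j hj => ?_,
    fun j hj Z hZ => ?_⟩
  · exact (hY.memCp_map hp1 ((levelL k).comp ((mulLeftL (ι A)).comp
      (toSeries (Module.finBasis ℝ V))))).congr fun t ht => congrFun (hSY ht) k
  · exact (solvesInNorm_mul_signature hι hp1 hp2 hab hx hS hj A).2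
  · exact (solvesInNorm_mul_signature hι hp1 hp2 hab hx hS hj A).1
  · exact hZ.eqOn hp1 hp2 hx (solvesInNorm_mul_signature hι hp1 hp2 hab hx hS hj A).2

end Main

theorem mainTheorem4
    {V : Type*} [NormedAddCommGroup V] [NormedSpace ℝ V] [FiniteDimensional ℝ V]
    {E : Type*} [NormedRing E] [NormedAlgebra ℝ E] [CompleteSpace E]
    (ι : E →ₐ[ℝ] TensorSeries V) (hι : Function.Injective ι)
    (p : ℝ) (hp1 : 1 ≤ p) (hp2 : p < 2) (a b : ℝ) (hab : a ≤ b)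
    (hE : signatureRange V p a b ⊆ Set.range ι)
    (x : ℝ → V) (hx : MemCp p x a b) :
    ∃ S : ℝ → E, (∀ t ∈ Set.Icc a b, ι (S t) = signature x a t) ∧
      (∀ A : E, IsUniqueSolution ι p x a b A (fun t => A * S t)) ∧
      IsUniqueSolution ι p x a b 1 S := by
  -- Outside `[a, b]` the value is arbitrary, since every assertion concerns `[a, b]` only.
  have h : ∀ t, ∃ s : E, t ∈ Icc a b → ι s = signature x a t := fun t => by
    by_cases ht : t ∈ Icc a b
    · obtain ⟨s, hs⟩ := hE (signature_mem_signatureRange hp1 hp2 hab hx ht)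
      exact ⟨s, fun _ => hs⟩
    · exact ⟨0, fun h => absurd h ht⟩
  choose S hS using h
  have hA := fun A => isUniqueSolution_mul_signature hι hp1 hp2 hab hx hS A
  refine ⟨S, hS, hA, ?_⟩
  simpa only [one_mul] using hA 1
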